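/- Let $d\ge 1$, $\alpha\in\mathbb R$, $0\le\sigma\le 1$, and let $W$ be a unitary operator on $\mathcal H_s=\mathbb C^d$ with canonical basis $e_0,\dots,e_{d-1}$. Let $\mathcal H_r=\ell^2(\mathbb Z)$ with canonical basis $(\Psi_j)_{j\in\mathbb Z}$ and shift $S\Psi_j=\Psi_{j-1}$. Write $\mathcal F_-(\mathcal H)$ for the antisymmetric Fock space over $\mathcal H$ and $\Gamma(\cdot)$ for second quantization; let $a^{*},a$ and $b^{*},b$ be the fermionic creation and annihilation operators on $\mathcal F_-(\mathcal H_s)$ and $\mathcal F_-(\mathcal H_r)$, generating the C*-algebras $\mathcal A$ and $\mathcal B$, and put $a_j^{\#}=a^{\#}(e_j)$, $b_j^{\#}=b^{\#}(\Psi_j)$. On $\mathcal F_-(\mathcal H_r)\otimes\mathcal F_-(\mathcal H_s)$ let $$U=(\Gamma(S)\otimes\Gamma(W))\,K,\qquad K=\exp[-i\alpha(b_0^*\otimes a_0+b_0\otimes a_0^*)],\qquad \tau^t(X)=U^{*t}XU^t .$$ Let $\omega$ be the gauge-invariant quasi-free state on $\mathcal B$ with density $\Sigma=\sigma\mathbb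 1$, that is, the state with $\omega(b^*(\phi_m)\cdots b^*(\phi_1)b(\psi_1)\cdots b(\psi_n))=\delta_{nm}\det(\langle\psi_j|\Sigma\phi_k\rangle)$ for all $m,n\in\mathbb N$ and all $\phi_i,\psi_i\in\mathcal H_r$. Let $\rho$ be a density matrix (a positive operator of trace one) on $\mathcal F_-(\mathcal H_s)$. For $t\in\mathbb N$ put $\rho_t(A)=(\omega\otimes\operatorname{tr}(\rho\,\cdot\,))(\tau^t(\mathbb 1\otimes A))$ for $A\in\mathcal A$. Let $\rho^{(1)}$ and $\rho^{(1)}_t$ be the one-body reduced density matrices, that is, the $d\times d$ matrices with entries $$\langle e_j|\rho^{(1)}e_k\rangle=\operatorname{tr}(\rho\,a_k^*a_j),\qquad \langle e_j|\rho^{(1)}_te_k\rangle=\rho_t(a_k^*a_j).$$ Set $$\mathbb M=W\big(\mathbb 1+(\cos\alpha-1)|e_0\rangle\langle e_0|\big),\qquad \mathbb B=\sigma\sin^2(\alpha)\,W|e_0\rangle\langle e_0|W^* .$$ Then $\rho^{(1)}_0=\rho^{(1)}$ and, for all $t\in\mathbb N$, $$\rho^{(1)}_{t+1}=\mathbb M\,\rho^{(1)}_t\,\mathbb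 M^*+\mathbb B .$$ Equivalently, for all $t\in\mathbb N$, $$\rho^{(1)}_t=\mathbb M^t\rho^{(1)}\mathbb M^{*t}+\sum_{r=0}^{t-1}\mathbb M^r\,\mathbb B\,\mathbb M^{*r}.$$ -/

import Mathlib

open scoped TensorProduct InnerProductSpace ComplexOrder

noncomputable section
namespace FermionicWalk

section Fock

variable {H : Type*} [NormedAddCommGroup H] [InnerProductSpace ℂ H]

/-- The annihilation operator `c(φ)` on the exterior algebra,
`c(φ) (u₁ ∧ ⋯ ∧ u_q) = ∑ j, (-1)^(j-1) ⟪φ, u_j⟫ u₁ ∧ ⋯ (omit u_j) ⋯ ∧ u_q`. -/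
def annih (φ : H) : ExteriorAlgebra ℂ H →ₗ[ℂ] ExteriorAlgebra ℂ H :=
  CliffordAlgebra.contractLeft (innerₛₗ ℂ φ)

lemma annih_ι_mul (φ u : H) (x : ExteriorAlgebra ℂ H) :
    annih φ (ExteriorAlgebra.ι ℂ u * x) = ⟪φ, u⟫_ℂ • x - ExteriorAlgebra.ι ℂ u * annih φ x := by
  simpa [annih] using CliffordAlgebra.contractLeft_ι_mul (Q := (0 : QuadraticForm ℂ H))
    (d := innerₛₗ ℂ φ) u x

lemma annih_algebraMap (φ : H) (r : ℂ) : annih φ (algebraMap ℂ (ExteriorAlgebra ℂ H) r) = 0 :=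
  CliffordAlgebra.contractLeft_algebraMap (Q := (0 : QuadraticForm ℂ H))
    (innerₛₗ ℂ φ) r

lemma annih_annih (φ : H) (x : ExteriorAlgebra ℂ H) : annih φ (annih φ x) = 0 :=
  CliffordAlgebra.contractLeft_contractLeft (Q := (0 : QuadraticForm ℂ H))
    (innerₛₗ ℂ φ) x

lemma annih_add (φ ψ : H) : annih (φ + ψ) = annih φ + annih ψ := by
  simp [annih]

lemma annih_smul (c : ℂ) (φ : H) : annih (c • φ) = (starRingEnd ℂ c) • annih φ := by
  simp [annih]

/-- An algebra with complex scalars acting through their conjugates. -/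
def ConjAlg (A : Type*) : Type _ := A

instance ConjAlg.instRing (A : Type*) [Ring A] : Ring (ConjAlg A) := inferInstanceAs (Ring A)

instance ConjAlg.instAlgebra (A : Type*) [Ring A] [Algebra ℂ A] : Algebra ℂ (ConjAlg A) :=
  RingHom.toAlgebra' ((algebraMap ℂ A).comp (starRingEnd ℂ))
    (fun _ _ => Algebra.commutes (A := A) _ _)

/-- The identity map, as an isomorphism of rings. -/
def ConjAlg.of (A : Type*) [Ring A] : A ≃+* ConjAlg A := RingEquiv.refl A

lemma ConjAlg.smul_of {A : Type*} [Ring A] [Algebra ℂ A] (c : ℂ) (x : A) :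
    c • ConjAlg.of A x = ConjAlg.of A ((starRingEnd ℂ c) • x) := by
  rw [Algebra.smul_def, Algebra.smul_def, map_mul]
  rfl

lemma ConjAlg.of_symm_smul {A : Type*} [Ring A] [Algebra ℂ A] (c : ℂ) (x : ConjAlg A) :
    (ConjAlg.of A).symm (c • x) = (starRingEnd ℂ c) • (ConjAlg.of A).symm x := by
  rw [RingEquiv.symm_apply_eq, ← ConjAlg.smul_of, RingEquiv.apply_symm_apply]

variable (H) in
/-- The opposite of the algebra of endomorphisms of the algebraic Fock space. -/
abbrev EndOp : Type _ := (Module.End ℂ (ExteriorAlgebra ℂ H))ᵐᵒᵖ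

/-- The conjugate-linear map sending `u₁ ∧ ⋯ ∧ uₚ` to `c(uₚ) ⋯ c(u₁)`. -/
def annihHom : ExteriorAlgebra ℂ H →ₐ[ℂ] ConjAlg (EndOp H) :=
  ExteriorAlgebra.lift ℂ
    ⟨{ toFun := fun u => ConjAlg.of (EndOp H) (MulOpposite.op (annih u))
       map_add' := fun u v => by rw [annih_add, MulOpposite.op_add, map_add]
       map_smul' := fun c u => by
        rw [annih_smul, MulOpposite.op_smul, ← ConjAlg.smul_of, RingHom.id_apply] },
     fun u => by
      change ConjAlg.of (EndOp H) (MulOpposite.op (annih u)) *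
        ConjAlg.of (EndOp H) (MulOpposite.op (annih u)) = 0
      rw [← map_mul, ← MulOpposite.op_mul, show annih u * annih u = 0 from
        LinearMap.ext fun x => annih_annih u x, MulOpposite.op_zero, map_zero]⟩

/-- The operator `c(uₚ) ⋯ c(u₁)` attached to `u₁ ∧ ⋯ ∧ uₚ`. -/
def annihWedge (x : ExteriorAlgebra ℂ H) : Module.End ℂ (ExteriorAlgebra ℂ H) :=
  MulOpposite.unop ((ConjAlg.of (EndOp H)).symm (annihHom x))

lemma annihWedge_ι_mul (u : H) (x y : ExteriorAlgebra ℂ H) :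
    annihWedge (ExteriorAlgebra.ι ℂ u * x) y = annihWedge x (annih u y) := by
  unfold annihWedge
  rw [map_mul, map_mul, MulOpposite.unop_mul, annihHom, ExteriorAlgebra.lift_ι_apply]
  rfl

lemma annihWedge_add (x x' : ExteriorAlgebra ℂ H) :
    annihWedge (x + x') = annihWedge x + annihWedge x' := by
  unfold annihWedge
  rw [map_add, map_add, MulOpposite.unop_add]

lemma annihWedge_smul (c : ℂ) (x : ExteriorAlgebra ℂ H) :
    annihWedge (c • x) = (starRingEnd ℂ c) • annihWedge x := by
  unfold annihWedge
  rw [map_smul, ConjAlg.of_symm_smul, MulOpposite.unop_smul]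

lemma annihWedge_algebraMap (c : ℂ) (y : ExteriorAlgebra ℂ H) :
    annihWedge (algebraMap ℂ _ c) y = (starRingEnd ℂ c) • y := by
  rw [Algebra.algebraMap_eq_smul_one, annihWedge_smul]
  have : annihWedge (1 : ExteriorAlgebra ℂ H) = 1 := by
    unfold annihWedge
    rw [map_one, map_one, MulOpposite.unop_one]
  simp [this]

/-- The inner product on the exterior algebra: `⟪u₁ ∧ ⋯ ∧ uₚ, y⟫` is the vacuum component of
`c(uₚ) ⋯ c(u₁) y`. Thus distinct degrees are orthogonal and
`⟪u₁ ∧ ⋯ ∧ uₚ, v₁ ∧ ⋯ ∧ vₚ⟫ = det ⟪uᵢ, vⱼ⟫`. -/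
def form (x y : ExteriorAlgebra ℂ H) : ℂ := ExteriorAlgebra.algebraMapInv (annihWedge x y)

lemma form_add_left (x x' y : ExteriorAlgebra ℂ H) : form (x + x') y = form x y + form x' y := by
  simp [form, annihWedge_add]

lemma form_smul_left (c : ℂ) (x y : ExteriorAlgebra ℂ H) :
    form (c • x) y = (starRingEnd ℂ c) * form x y := by
  simp [form, annihWedge_smul]

lemma form_add_right (x y y' : ExteriorAlgebra ℂ H) : form x (y + y') = form x y + form x y' := by
  simp [form]

lemma form_sub_right (x y y' : ExteriorAlgebra ℂ H) : form x (y - y') = form x y - form x y' := by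
  simp [form]

lemma form_smul_right (c : ℂ) (x y : ExteriorAlgebra ℂ H) : form x (c • y) = c * form x y := by
  simp [form]

lemma form_sub_left (x x' y : ExteriorAlgebra ℂ H) : form (x - x') y = form x y - form x' y := by
  rw [sub_eq_add_neg, form_add_left, ← neg_one_smul ℂ x', form_smul_left]
  simp [sub_eq_add_neg]

lemma form_ι_mul_left (u : H) (x y : ExteriorAlgebra ℂ H) :
    form (ExteriorAlgebra.ι ℂ u * x) y = form x (annih u y) := by
  simp [form, annihWedge_ι_mul]

lemma form_algebraMap_left (c : ℂ) (y : ExteriorAlgebra ℂ H) :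
    form (algebraMap ℂ _ c) y = (starRingEnd ℂ c) * ExteriorAlgebra.algebraMapInv y := by
  simp [form, annihWedge_algebraMap]

lemma form_annih_left (u : H) (x y : ExteriorAlgebra ℂ H) :
    form (annih u x) y = form x (ExteriorAlgebra.ι ℂ u * y) := by
  induction x using CliffordAlgebra.left_induction generalizing y with
  | algebraMap r =>
    change form (annih u (algebraMap ℂ (ExteriorAlgebra ℂ H) r)) y =
      form (algebraMap ℂ (ExteriorAlgebra ℂ H) r) _
    have h0 : form (0 : ExteriorAlgebra ℂ H) y = 0 := by
      simpa using form_smul_left 0 (0 : ExteriorAlgebra ℂ H) y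
    rw [annih_algebraMap, form_algebraMap_left, h0, map_mul]
    simp [ExteriorAlgebra.algebraMapInv]
  | add x x' hx hx' => simp [form_add_left, hx, hx']
  | ι_mul x v hx =>
    change form (annih u (ExteriorAlgebra.ι ℂ v * x)) y = form (ExteriorAlgebra.ι ℂ v * x) _
    rw [annih_ι_mul, form_sub_left, form_smul_left, form_ι_mul_left, form_ι_mul_left, hx,
      annih_ι_mul, form_sub_right, form_smul_right]
    simp

lemma form_conj_symm (x y : ExteriorAlgebra ℂ H) : (starRingEnd ℂ) (form y x) = form x y := by
  have key (r : ℂ) (y : ExteriorAlgebra ℂ H) :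
      (starRingEnd ℂ) (form y (algebraMap ℂ _ r)) = form (algebraMap ℂ _ r) y := by
    induction y using CliffordAlgebra.left_induction with
    | algebraMap r' =>
      change (starRingEnd ℂ) (form (algebraMap ℂ (ExteriorAlgebra ℂ H) r') _) = form _ (algebraMap ℂ (ExteriorAlgebra ℂ H) r')
      rw [form_algebraMap_left, form_algebraMap_left, ExteriorAlgebra.algebraMap_leftInverse,
        ExteriorAlgebra.algebraMap_leftInverse]
      simp [mul_comm]
    | add y y' hy hy' => rw [form_add_left, form_add_right, map_add, hy, hy']
    | ι_mul y v hy =>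
      change (starRingEnd ℂ) (form (ExteriorAlgebra.ι ℂ v * y) _) =
        form _ (ExteriorAlgebra.ι ℂ v * y)
      have h0 : form y (0 : ExteriorAlgebra ℂ H) = 0 := by
        simpa using form_smul_right 0 y (0 : ExteriorAlgebra ℂ H)
      rw [form_ι_mul_left, annih_algebraMap, h0, form_algebraMap_left, map_mul]
      simp [ExteriorAlgebra.algebraMapInv]
  induction x using CliffordAlgebra.left_induction generalizing y with
  | algebraMap r => exact key r y
  | add x x' hx hx' => rw [form_add_left, form_add_right, map_add, hx, hx']
  | ι_mul x v hx =>
    change (starRingEnd ℂ) (form y (ExteriorAlgebra.ι ℂ v * x)) =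
      form (ExteriorAlgebra.ι ℂ v * x) y
    rw [form_ι_mul_left, ← form_annih_left, hx]

lemma annih_eq_zero_of_mem_adjoin {φ : H} {s : Set H} (hs : ∀ u ∈ s, ⟪φ, u⟫_ℂ = 0)
    {x : ExteriorAlgebra ℂ H} (hx : x ∈ Algebra.adjoin ℂ (ExteriorAlgebra.ι ℂ '' s)) :
    annih φ x = 0 := by
  suffices h : ∀ w, annih φ w = 0 → annih φ (x * w) = 0 by
    simpa using h 1 (by simpa using annih_algebraMap φ 1)
  induction hx using Algebra.adjoin_induction with
  | mem x hx =>
    obtain ⟨u, hu, rfl⟩ := hx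
    intro w hw
    rw [annih_ι_mul, hs u hu, hw]
    simp
  | algebraMap r =>
    intro w hw
    rw [← Algebra.smul_def, map_smul, hw, smul_zero]
  | add x y _ _ hx hy =>
    intro w hw
    rw [add_mul, map_add, hx w hw, hy w hw, add_zero]
  | mul x y _ _ hx hy =>
    intro w hw
    rw [mul_assoc]
    exact hx _ (hy _ hw)

lemma exists_of_mem_adjoin_insert {u : H} {s : Set H} {x : ExteriorAlgebra ℂ H}
    (hx : x ∈ Algebra.adjoin ℂ (ExteriorAlgebra.ι ℂ '' insert u s)) :
    ∃ y ∈ Algebra.adjoin ℂ (ExteriorAlgebra.ι ℂ '' s),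
    ∃ z ∈ Algebra.adjoin ℂ (ExteriorAlgebra.ι ℂ '' s), x = y + ExteriorAlgebra.ι ℂ u * z := by
  suffices h : ∀ y ∈ Algebra.adjoin ℂ (ExteriorAlgebra.ι ℂ '' s),
      ∀ z ∈ Algebra.adjoin ℂ (ExteriorAlgebra.ι ℂ '' s),
      ∃ y' ∈ Algebra.adjoin ℂ (ExteriorAlgebra.ι ℂ '' s),
      ∃ z' ∈ Algebra.adjoin ℂ (ExteriorAlgebra.ι ℂ '' s),
        x * (y + ExteriorAlgebra.ι ℂ u * z) = y' + ExteriorAlgebra.ι ℂ u * z' by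
    simpa using h 1 (one_mem _) 0 (zero_mem _)
  induction hx using Algebra.adjoin_induction with
  | mem x hx =>
    obtain ⟨v, hv, rfl⟩ := hx
    intro y hy z hz
    rcases hv with rfl | hv
    · refine ⟨0, zero_mem _, y, hy, ?_⟩
      rw [mul_add, ← mul_assoc, ExteriorAlgebra.ι_sq_zero]
      simp
    · have hv' : ExteriorAlgebra.ι ℂ v ∈ Algebra.adjoin ℂ (ExteriorAlgebra.ι ℂ '' s) :=
        Algebra.subset_adjoin ⟨v, hv, rfl⟩
      refine ⟨_, mul_mem hv' hy, - (ExteriorAlgebra.ι ℂ v * z), neg_mem (mul_mem hv' hz), ?_⟩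
      have h := eq_neg_of_add_eq_zero_left (ExteriorAlgebra.ι_add_mul_swap (R := ℂ) v u)
      rw [mul_add, ← mul_assoc, h]
      simp [mul_assoc]
  | algebraMap r =>
    intro y hy z hz
    refine ⟨r • y, Subalgebra.smul_mem _ hy r, r • z, Subalgebra.smul_mem _ hz r, ?_⟩
    rw [← Algebra.smul_def, smul_add, mul_smul_comm]
  | add x x' _ _ hx hx' =>
    intro y hy z hz
    obtain ⟨y₁, hy₁, z₁, hz₁, h₁⟩ := hx y hy z hz
    obtain ⟨y₂, hy₂, z₂, hz₂, h₂⟩ := hx' y hy z hz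
    refine ⟨_, add_mem hy₁ hy₂, _, add_mem hz₁ hz₂, ?_⟩
    rw [add_mul, h₁, h₂, mul_add]
    abel
  | mul x x' _ _ hx hx' =>
    intro y hy z hz
    obtain ⟨y₁, hy₁, z₁, hz₁, h₁⟩ := hx' y hy z hz
    rw [mul_assoc, h₁]
    exact hx y₁ hy₁ z₁ hz₁

lemma form_self_of_mem_adjoin {n : Type*} {e : n → H} (he : Orthonormal ℂ e) (s : Finset n)
    (x : ExteriorAlgebra ℂ H) (hx : x ∈ Algebra.adjoin ℂ (ExteriorAlgebra.ι ℂ '' (e '' s))) :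
    0 ≤ form x x ∧ (form x x = 0 → x = 0) := by
  classical
  induction s using Finset.induction_on generalizing x with
  | empty =>
    simp only [Finset.coe_empty, Set.image_empty, Algebra.adjoin_empty] at hx
    obtain ⟨r, rfl⟩ := Algebra.mem_bot.1 hx
    rw [form_algebraMap_left, ExteriorAlgebra.algebraMap_leftInverse, ← Complex.normSq_eq_conj_mul_self]
    refine ⟨by exact_mod_cast Complex.normSq_nonneg r, fun h => ?_⟩
    have : r = 0 := by simpa using h
    simp [this]
  | insert i s hi ih =>
    rw [Finset.coe_insert, Set.image_insert_eq] at hx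
    obtain ⟨y, hy, z, hz, rfl⟩ := exists_of_mem_adjoin_insert hx
    have ho : ∀ u ∈ e '' s, ⟪e i, u⟫_ℂ = 0 := by
      rintro _ ⟨j, hj, rfl⟩
      exact he.inner_eq_zero fun h => hi (h ▸ hj)
    have hy0 := annih_eq_zero_of_mem_adjoin ho hy
    have hz0 := annih_eq_zero_of_mem_adjoin ho hz
    have h0 (w : ExteriorAlgebra ℂ H) : form w 0 = 0 := by
      simpa using form_smul_right 0 w (0 : ExteriorAlgebra ℂ H)
    have h0' (w : ExteriorAlgebra ℂ H) : form 0 w = 0 := by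
      simpa using form_smul_left 0 (0 : ExteriorAlgebra ℂ H) w
    have key : form (y + ExteriorAlgebra.ι ℂ (e i) * z) (y + ExteriorAlgebra.ι ℂ (e i) * z) =
        form y y + form z z := by
      rw [form_add_right, form_add_left, form_add_left, form_ι_mul_left, ← form_annih_left,
        form_ι_mul_left, annih_ι_mul, hy0, hz0, mul_zero, sub_zero, h0, h0',
        inner_self_eq_norm_sq_to_K, he.1 i]
      simp
    obtain ⟨hy1, hy2⟩ := ih y hy
    obtain ⟨hz1, hz2⟩ := ih z hz
    rw [key]
    refine ⟨add_nonneg hy1 hz1, fun h => ?_⟩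
    obtain ⟨h1, h2⟩ := (add_eq_zero_iff_of_nonneg hy1 hz1).1 h
    rw [hy2 h1, hz2 h2]
    simp

lemma exists_mem_adjoin (x : ExteriorAlgebra ℂ H) :
    ∃ t : Finset H, x ∈ Algebra.adjoin ℂ (ExteriorAlgebra.ι ℂ '' (t : Set H)) := by
  classical
  have mono {t t' : Finset H} (h : t ⊆ t') :
      Algebra.adjoin ℂ (ExteriorAlgebra.ι ℂ '' (t : Set H)) ≤
        Algebra.adjoin ℂ (ExteriorAlgebra.ι ℂ '' (t' : Set H)) :=
    Algebra.adjoin_mono (Set.image_mono (by exact_mod_cast h))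
  induction x using ExteriorAlgebra.induction with
  | algebraMap r => exact ⟨∅, Subalgebra.algebraMap_mem _ r⟩
  | ι u => exact ⟨{u}, Algebra.subset_adjoin ⟨u, by simp, rfl⟩⟩
  | mul a b ha hb =>
    obtain ⟨t, ht⟩ := ha
    obtain ⟨t', ht'⟩ := hb
    exact ⟨t ∪ t', mul_mem (mono Finset.subset_union_left ht) (mono Finset.subset_union_right ht')⟩
  | add a b ha hb =>
    obtain ⟨t, ht⟩ := ha
    obtain ⟨t', ht'⟩ := hb
    exact ⟨t ∪ t', add_mem (mono Finset.subset_union_left ht) (mono Finset.subset_union_right ht')⟩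

lemma form_self (x : ExteriorAlgebra ℂ H) : 0 ≤ form x x ∧ (form x x = 0 → x = 0) := by
  obtain ⟨t, ht⟩ := exists_mem_adjoin x
  let K := Submodule.span ℂ (t : Set H)
  let b := stdOrthonormalBasis ℂ K
  have hb : Orthonormal ℂ (fun i => (b i : H)) := by
    simpa using! b.orthonormal.comp_linearIsometry K.subtypeₗᵢ
  refine form_self_of_mem_adjoin hb Finset.univ x ?_
  refine (Algebra.adjoin_le ?_ : Algebra.adjoin ℂ (ExteriorAlgebra.ι ℂ '' (t : Set H)) ≤ _) ht
  rintro _ ⟨u, hu, rfl⟩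
  have hu' : u = ∑ i, b.repr ⟨u, Submodule.subset_span hu⟩ i • (b i : H) := by
    have := congrArg (Subtype.val) (b.sum_repr ⟨u, Submodule.subset_span hu⟩)
    simpa using this.symm
  rw [hu', map_sum]
  refine Subalgebra.sum_mem _ fun i _ => ?_
  rw [map_smul]
  exact Subalgebra.smul_mem _ (Algebra.subset_adjoin (Set.mem_image_of_mem _
    (Set.mem_image_of_mem (fun i => (b i : H)) (Finset.mem_coe.2 (Finset.mem_univ i))))) _

instance instCore : InnerProductSpace.Core ℂ (ExteriorAlgebra ℂ H) where
  inner x y := form x y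
  conj_inner_symm := form_conj_symm
  add_left := form_add_left
  smul_left x y c := form_smul_left c x y
  re_inner_nonneg x := (Complex.le_def.1 (form_self x).1).1
  definite x h := (form_self x).2 h

instance instNormed : NormedAddCommGroup (ExteriorAlgebra ℂ H) :=
  InnerProductSpace.Core.toNormedAddCommGroup (𝕜 := ℂ)

instance instInner : InnerProductSpace ℂ (ExteriorAlgebra ℂ H) :=
  InnerProductSpace.ofCore _

lemma inner_ι_mul_left (u : H) (x y : ExteriorAlgebra ℂ H) :
    ⟪ExteriorAlgebra.ι ℂ u * x, y⟫_ℂ = ⟪x, annih u y⟫_ℂ := form_ι_mul_left u x y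

lemma inner_annih_left (u : H) (x y : ExteriorAlgebra ℂ H) :
    ⟪annih u x, y⟫_ℂ = ⟪x, ExteriorAlgebra.ι ℂ u * y⟫_ℂ := form_annih_left u x y

lemma norm_ι_mul_le (u : H) (x : ExteriorAlgebra ℂ H) :
    ‖ExteriorAlgebra.ι ℂ u * x‖ ≤ ‖u‖ * ‖x‖ := by
  have h : ⟪ExteriorAlgebra.ι ℂ u * x, ExteriorAlgebra.ι ℂ u * x⟫_ℂ =
      ⟪u, u⟫_ℂ * ⟪x, x⟫_ℂ - ⟪annih u x, annih u x⟫_ℂ := by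
    rw [inner_ι_mul_left, annih_ι_mul, inner_sub_right, inner_smul_right, inner_annih_left]
  have h' : ‖ExteriorAlgebra.ι ℂ u * x‖ ^ 2 = (‖u‖ * ‖x‖) ^ 2 - ‖annih u x‖ ^ 2 := by
    simp only [inner_self_eq_norm_sq_to_K] at h
    rw [mul_pow]
    exact_mod_cast h
  refine le_of_sq_le_sq ?_ (by positivity)
  nlinarith [sq_nonneg ‖annih u x‖]

variable (H) in
/-- The antisymmetric Fock space over `H`: the Hilbert space completion of the exterior algebra for
the inner product with `⟪u₁ ∧ ⋯ ∧ uₚ, v₁ ∧ ⋯ ∧ vₚ⟫ = det ⟪uᵢ, vⱼ⟫`. -/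
def Fock : Type _ := UniformSpace.Completion (ExteriorAlgebra ℂ H)

instance : NormedAddCommGroup (Fock H) :=
  inferInstanceAs (NormedAddCommGroup (UniformSpace.Completion (ExteriorAlgebra ℂ H)))

instance : InnerProductSpace ℂ (Fock H) :=
  inferInstanceAs (InnerProductSpace ℂ (UniformSpace.Completion (ExteriorAlgebra ℂ H)))

instance : CompleteSpace (Fock H) :=
  inferInstanceAs (CompleteSpace (UniformSpace.Completion (ExteriorAlgebra ℂ H)))

variable (H) in
/-- The canonical inclusion of the exterior algebra into the Fock space. -/
def Fock.incl : ExteriorAlgebra ℂ H →ₗᵢ[ℂ] Fock H :=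
  (UniformSpace.Completion.toComplₗᵢ : _ →ₗᵢ[ℂ] UniformSpace.Completion (ExteriorAlgebra ℂ H))

lemma Fock.denseRange_incl : DenseRange (Fock.incl H) :=
  UniformSpace.Completion.denseRange_coe (α := ExteriorAlgebra ℂ H)

/-- The continuous linear extension to the Fock space of a bounded operator on the exterior
algebra. -/
def Fock.extend (f : ExteriorAlgebra ℂ H →L[ℂ] ExteriorAlgebra ℂ H) : Fock H →L[ℂ] Fock H :=
  (f.completion : UniformSpace.Completion (ExteriorAlgebra ℂ H) →L[ℂ]
    UniformSpace.Completion (ExteriorAlgebra ℂ H))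

lemma Fock.extend_incl (f : ExteriorAlgebra ℂ H →L[ℂ] ExteriorAlgebra ℂ H)
    (x : ExteriorAlgebra ℂ H) : Fock.extend f (Fock.incl H x) = Fock.incl H (f x) :=
  ContinuousLinearMap.completion_apply_coe _ _

/-- The creation operator `c*(φ)`, with `c*(φ) (u₁ ∧ ⋯ ∧ u_q) = φ ∧ u₁ ∧ ⋯ ∧ u_q`. -/
def create (φ : H) : Fock H →L[ℂ] Fock H :=
  Fock.extend (LinearMap.mkContinuous (LinearMap.mulLeft ℂ (ExteriorAlgebra.ι ℂ φ)) ‖φ‖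
    (norm_ι_mul_le φ))

/-- The annihilation operator `c(φ)`, the adjoint of `c*(φ)`. -/
def annihilate (φ : H) : Fock H →L[ℂ] Fock H := (create φ).adjoint

variable {H' : Type*} [NormedAddCommGroup H'] [InnerProductSpace ℂ H']

lemma annih_map (V : H →ₗᵢ[ℂ] H') (u : H) (x : ExteriorAlgebra ℂ H) :
    annih (V u) (ExteriorAlgebra.map V.toLinearMap x) =
      ExteriorAlgebra.map V.toLinearMap (annih u x) := by
  induction x using CliffordAlgebra.left_induction with
  | algebraMap r =>
    have h1 := annih_algebraMap u r
    have h2 := annih_algebraMap (V u) r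
    change annih (V u) (ExteriorAlgebra.map V.toLinearMap (algebraMap ℂ (ExteriorAlgebra ℂ H) r)) =
      ExteriorAlgebra.map V.toLinearMap (annih u (algebraMap ℂ (ExteriorAlgebra ℂ H) r))
    rw [AlgHom.commutes, h1, h2, map_zero]
  | add x x' hx hx' => simp only [map_add, hx, hx']
  | ι_mul x v hx =>
    change annih (V u) (ExteriorAlgebra.map V.toLinearMap (ExteriorAlgebra.ι ℂ v * x)) =
      ExteriorAlgebra.map V.toLinearMap (annih u (ExteriorAlgebra.ι ℂ v * x))
    have h : ⟪V u, V.toLinearMap v⟫_ℂ = ⟪u, v⟫_ℂ := V.inner_map_map u v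
    rw [map_mul, ExteriorAlgebra.map_apply_ι, annih_ι_mul, annih_ι_mul, hx, h]
    erw [map_sub, map_smul, map_mul, ExteriorAlgebra.map_apply_ι]

lemma inner_map_map (V : H →ₗᵢ[ℂ] H') (x y : ExteriorAlgebra ℂ H) :
    ⟪ExteriorAlgebra.map V.toLinearMap x, ExteriorAlgebra.map V.toLinearMap y⟫_ℂ = ⟪x, y⟫_ℂ := by
  induction x using CliffordAlgebra.left_induction generalizing y with
  | algebraMap r =>
    change form (ExteriorAlgebra.map V.toLinearMap (algebraMap ℂ (ExteriorAlgebra ℂ H) r)) _ =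
      form (algebraMap ℂ (ExteriorAlgebra ℂ H) r) _
    rw [AlgHom.commutes, form_algebraMap_left, form_algebraMap_left]
    congr 1
    induction y using CliffordAlgebra.left_induction with
    | algebraMap r =>
      change ExteriorAlgebra.algebraMapInv (ExteriorAlgebra.map V.toLinearMap
        (algebraMap ℂ (ExteriorAlgebra ℂ H) r)) = ExteriorAlgebra.algebraMapInv
        (algebraMap ℂ (ExteriorAlgebra ℂ H) r)
      rw [AlgHom.commutes, ExteriorAlgebra.algebraMap_leftInverse,
        ExteriorAlgebra.algebraMap_leftInverse]
    | add x x' hx hx' => rw [map_add, map_add, map_add, hx, hx']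
    | ι_mul x v hx =>
      change ExteriorAlgebra.algebraMapInv (ExteriorAlgebra.map V.toLinearMap
        (ExteriorAlgebra.ι ℂ v * x)) = ExteriorAlgebra.algebraMapInv (ExteriorAlgebra.ι ℂ v * x)
      rw [map_mul, map_mul, map_mul, ExteriorAlgebra.map_apply_ι]
      simp [ExteriorAlgebra.algebraMapInv]
  | add x x' hx hx' => rw [map_add, inner_add_left, inner_add_left, hx, hx']
  | ι_mul x v hx =>
    change ⟪ExteriorAlgebra.map V.toLinearMap (ExteriorAlgebra.ι ℂ v * x), _⟫_ℂ =
      ⟪ExteriorAlgebra.ι ℂ v * x, y⟫_ℂ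
    rw [map_mul, ExteriorAlgebra.map_apply_ι, inner_ι_mul_left, inner_ι_mul_left]
    exact (congrArg _ (annih_map V v y)).trans (hx _)

/-- The isometry `u₁ ∧ ⋯ ∧ uₚ ↦ V u₁ ∧ ⋯ ∧ V uₚ` of exterior algebras. -/
def mapIsometry (V : H →ₗᵢ[ℂ] H') : ExteriorAlgebra ℂ H →ₗᵢ[ℂ] ExteriorAlgebra ℂ H' where
  toLinearMap := (ExteriorAlgebra.map V.toLinearMap).toLinearMap
  norm_map' x := by
    rw [← sq_eq_sq₀ (norm_nonneg _) (norm_nonneg _)]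
    have h := inner_map_map V x x
    simp only [inner_self_eq_norm_sq_to_K] at h
    exact_mod_cast h

/-- The second quantization `Γ(V)`, with `Γ(V) (u₁ ∧ ⋯ ∧ uₚ) = V u₁ ∧ ⋯ ∧ V uₚ`. -/
def secondQuant (V : H ≃ₗᵢ[ℂ] H) : Fock H →L[ℂ] Fock H :=
  Fock.extend (mapIsometry V.toLinearIsometry).toContinuousLinearMap

lemma secondQuant_incl (V : H ≃ₗᵢ[ℂ] H) (x : ExteriorAlgebra ℂ H) :
    secondQuant V (Fock.incl H x) =
      Fock.incl H (ExteriorAlgebra.map V.toLinearEquiv.toLinearMap x) :=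
  Fock.extend_incl _ _

lemma create_incl (φ : H) (x : ExteriorAlgebra ℂ H) :
    create φ (Fock.incl H x) = Fock.incl H (ExteriorAlgebra.ι ℂ φ * x) :=
  Fock.extend_incl _ _

lemma Fock.ext {E : Type*} [NormedAddCommGroup E] [NormedSpace ℂ E] {A B : Fock H →L[ℂ] E}
    (h : ∀ x : ExteriorAlgebra ℂ H, A (Fock.incl H x) = B (Fock.incl H x)) : A = B := by
  ext x
  induction x using Fock.denseRange_incl.induction_on with
  | hp => exact isClosed_eq A.continuous B.continuous
  | ih x => exact h x

lemma secondQuant_mul (V V' : H ≃ₗᵢ[ℂ] H) :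
    secondQuant V * secondQuant V' = secondQuant (V'.trans V) := by
  refine Fock.ext fun x => ?_
  rw [mul_apply_eq_comp, secondQuant_incl, secondQuant_incl, secondQuant_incl,
    ← AlgHom.comp_apply, ExteriorAlgebra.map_comp_map]
  rfl

lemma secondQuant_refl : secondQuant (LinearIsometryEquiv.refl ℂ H) = 1 := by
  refine Fock.ext fun x => ?_
  rw [secondQuant_incl]
  exact congrArg _ (congrArg (fun f => f x) (ExteriorAlgebra.map_id (R := ℂ) (M := H)))

lemma secondQuant_adjoint (V : H ≃ₗᵢ[ℂ] H) :
    (secondQuant V).adjoint = secondQuant V.symm := by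
  have h : (secondQuant V).adjoint * secondQuant V = 1 := by
    refine Fock.ext fun x => ext_inner_left ℂ fun y => ?_
    rw [mul_apply_eq_comp, ContinuousLinearMap.adjoint_inner_right,
      one_apply_eq_self]
    induction y using Fock.denseRange_incl.induction_on with
    | hp => exact isClosed_eq (by fun_prop) (by fun_prop)
    | ih y =>
      rw [secondQuant_incl, secondQuant_incl, LinearIsometry.inner_map_map,
        LinearIsometry.inner_map_map]
      exact inner_map_map V.toLinearIsometry y x
  have h' : secondQuant V * secondQuant V.symm = 1 := by
    rw [secondQuant_mul, V.symm_trans_self, secondQuant_refl]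
  rw [← mul_one (secondQuant V).adjoint, ← h', ← mul_assoc, h, one_mul]

lemma secondQuant_create (V : H ≃ₗᵢ[ℂ] H) (φ : H) :
    secondQuant V * create φ = create (V φ) * secondQuant V := by
  refine Fock.ext fun x => ?_
  rw [mul_apply_eq_comp, mul_apply_eq_comp, create_incl, secondQuant_incl,
    secondQuant_incl, create_incl, map_mul, ExteriorAlgebra.map_apply_ι]
  rfl

instance instFiniteDimensionalFock [FiniteDimensional ℂ H] : FiniteDimensional ℂ (Fock H) := by
  have : FiniteDimensional ℂ (ExteriorAlgebra ℂ H) :=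
    Module.Finite.of_basis (Module.finBasis ℂ H).ExteriorAlgebra
  have hc : CompleteSpace (ExteriorAlgebra ℂ H) := FiniteDimensional.complete ℂ _
  refine Module.Finite.of_surjective (Fock.incl H).toLinearMap ?_
  have h2 : IsClosed (Set.range (Fock.incl H)) :=
    (Fock.incl H).isometry.isUniformInducing.isComplete_range.isClosed
  exact Set.range_eq_univ.1 (h2.closure_eq ▸ Fock.denseRange_incl.closure_range)

/-- The C*-algebra generated by the creation and annihilation operators. -/
def carAlgebra (H : Type*) [NormedAddCommGroup H] [InnerProductSpace ℂ H] :
    StarSubalgebra ℂ (Fock H →L[ℂ] Fock H) :=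
  (StarAlgebra.adjoin ℂ (Set.range create)).topologicalClosure

lemma create_mem (φ : H) : create φ ∈ carAlgebra H :=
  StarSubalgebra.le_topologicalClosure _ (StarAlgebra.subset_adjoin ℂ _ ⟨φ, rfl⟩)

lemma annihilate_mem (φ : H) : annihilate φ ∈ carAlgebra H := star_mem (create_mem φ)

/-- The creation operator as element of the CAR algebra. -/
def creator (φ : H) : carAlgebra H := ⟨create φ, create_mem φ⟩

/-- The annihilation operator as element of the CAR algebra. -/
def annihilator (φ : H) : carAlgebra H := ⟨annihilate φ, annihilate_mem φ⟩

/-- States on the CAR algebra: positive normalised linear functionals. -/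
def IsState (ω : carAlgebra H →ₗ[ℂ] ℂ) : Prop := ω 1 = 1 ∧ ∀ x, 0 ≤ ω (star x * x)

/-- Gauge-invariant quasi-free functionals with density operator `T`:
`ω(c*(φₘ) ⋯ c*(φ₁) c(ψ₁) ⋯ c(ψₙ)) = δₘₙ det ⟪ψⱼ, T φₖ⟫`. -/
def IsQuasiFree (ω : carAlgebra H →ₗ[ℂ] ℂ) (T : H →L[ℂ] H) : Prop :=
  (∀ (n : ℕ) (φ ψ : Fin n → H),
    ω ((List.ofFn fun i => creator (φ i)).reverse.prod * (List.ofFn fun i => annihilator (ψ i)).prod) =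
      (Matrix.of fun j k => ⟪ψ j, T (φ k)⟫_ℂ).det) ∧
  ∀ (m n : ℕ) (φ : Fin m → H) (ψ : Fin n → H), m ≠ n →
    ω ((List.ofFn fun i => creator (φ i)).reverse.prod * (List.ofFn fun i => annihilator (ψ i)).prod) = 0

lemma conj_mem_of_adjoin {E : Type*} [NormedAddCommGroup E] [InnerProductSpace ℂ E]
    [CompleteSpace E] {u : E →L[ℂ] E} (hu : u ∈ unitary (E →L[ℂ] E)) {s : Set (E →L[ℂ] E)}
    {T : StarSubalgebra ℂ (E →L[ℂ] E)} (hT : IsClosed (T : Set (E →L[ℂ] E)))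
    (hs : ∀ x ∈ s, star u * x * u ∈ T) {x : E →L[ℂ] E}
    (hx : x ∈ (StarAlgebra.adjoin ℂ s).topologicalClosure) : star u * x * u ∈ T := by
  let f : (E →L[ℂ] E) →⋆ₐ[ℂ] (E →L[ℂ] E) :=
    StarAlgHomClass.toStarAlgHom (Unitary.conjStarAlgAut ℂ (E →L[ℂ] E) (star ⟨u, hu⟩))
  have hf (x : E →L[ℂ] E) : f x = star u * x * u := by
    change Unitary.conjStarAlgAut ℂ (E →L[ℂ] E) (star ⟨u, hu⟩) x = _
    simp [Unitary.conjStarAlgAut_apply]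
  have h : (StarAlgebra.adjoin ℂ s).topologicalClosure ≤
      T.comap f := by
    refine StarSubalgebra.topologicalClosure_minimal (StarAlgebra.adjoin_le fun x hx => ?_) ?_
    · change f x ∈ T
      rw [hf]
      exact hs x hx
    · change IsClosed (f ⁻¹' (T : Set (E →L[ℂ] E)))
      refine hT.preimage ?_
      have : (f : (E →L[ℂ] E) → (E →L[ℂ] E)) = fun x => star u * x * u := funext hf
      rw [this]
      fun_prop
  rw [← hf]
  exact h hx

lemma secondQuant_unitary (V : H ≃ₗᵢ[ℂ] H) : secondQuant V ∈ unitary (Fock H →L[ℂ] Fock H) := by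
  rw [Unitary.mem_iff, ContinuousLinearMap.star_eq_adjoint, secondQuant_adjoint, secondQuant_mul,
    secondQuant_mul, V.symm_trans_self, V.self_trans_symm]
  exact ⟨secondQuant_refl, secondQuant_refl⟩

lemma secondQuant_conj_mem (V : H ≃ₗᵢ[ℂ] H) {x : Fock H →L[ℂ] Fock H} (hx : x ∈ carAlgebra H) :
    star (secondQuant V) * x * secondQuant V ∈ carAlgebra H := by
  refine conj_mem_of_adjoin (secondQuant_unitary V)
    (StarSubalgebra.isClosed_topologicalClosure _) ?_ hx
  rintro _ ⟨φ, rfl⟩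
  have h := secondQuant_create V (V.symm φ)
  rw [V.apply_symm_apply] at h
  rw [mul_assoc, ← h, ← mul_assoc, (Unitary.mem_iff.1 (secondQuant_unitary V)).1, one_mul]
  exact create_mem _

end Fock

section Composite

variable {H K : Type*} [NormedAddCommGroup H] [InnerProductSpace ℂ H]
  [NormedAddCommGroup K] [InnerProductSpace ℂ K]

variable (H K) in
/-- The Hilbert space tensor product of the Fock spaces over `H` and `K`. -/
def Composite : Type _ := UniformSpace.Completion (Fock H ⊗[ℂ] Fock K)

instance : NormedAddCommGroup (Composite H K) :=
  inferInstanceAs (NormedAddCommGroup (UniformSpace.Completion (Fock H ⊗[ℂ] Fock K)))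

instance : InnerProductSpace ℂ (Composite H K) :=
  inferInstanceAs (InnerProductSpace ℂ (UniformSpace.Completion (Fock H ⊗[ℂ] Fock K)))

instance : CompleteSpace (Composite H K) :=
  inferInstanceAs (CompleteSpace (UniformSpace.Completion (Fock H ⊗[ℂ] Fock K)))

variable (H K) in
/-- The canonical inclusion of the algebraic tensor product. -/
def Composite.incl : Fock H ⊗[ℂ] Fock K →ₗᵢ[ℂ] Composite H K :=
  (UniformSpace.Completion.toComplₗᵢ : _ →ₗᵢ[ℂ] UniformSpace.Completion (Fock H ⊗[ℂ] Fock K))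

lemma Composite.denseRange_incl : DenseRange (Composite.incl H K) :=
  UniformSpace.Completion.denseRange_coe (α := Fock H ⊗[ℂ] Fock K)

/-- The operator `A ⊗ B` on the Hilbert space tensor product. -/
def opTensor (A : Fock H →L[ℂ] Fock H) (B : Fock K →L[ℂ] Fock K) :
    Composite H K →L[ℂ] Composite H K :=
  ((TensorProduct.mapL A B).completion : UniformSpace.Completion (Fock H ⊗[ℂ] Fock K) →L[ℂ]
    UniformSpace.Completion (Fock H ⊗[ℂ] Fock K))

lemma opTensor_tmul (A : Fock H →L[ℂ] Fock H) (B : Fock K →L[ℂ] Fock K) (x : Fock H) (y : Fock K) :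
    opTensor A B (Composite.incl H K (x ⊗ₜ y)) = Composite.incl H K (A x ⊗ₜ B y) :=
  ContinuousLinearMap.completion_apply_coe _ _

lemma Composite.ext {E : Type*} [NormedAddCommGroup E] [NormedSpace ℂ E]
    {A B : Composite H K →L[ℂ] E}
    (h : ∀ x y, A (Composite.incl H K (x ⊗ₜ y)) = B (Composite.incl H K (x ⊗ₜ y))) : A = B := by
  ext x
  induction x using Composite.denseRange_incl.induction_on with
  | hp => exact isClosed_eq A.continuous B.continuous
  | ih x =>
    induction x using TensorProduct.induction_on with
    | zero => simp
    | tmul x y => exact h x y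
    | add x y hx hy => rw [map_add, map_add, map_add, hx, hy]

lemma opTensor_mul (A A' : Fock H →L[ℂ] Fock H) (B B' : Fock K →L[ℂ] Fock K) :
    opTensor A B * opTensor A' B' = opTensor (A * A') (B * B') :=
  Composite.ext fun x y => by simp only [opTensor_tmul, mul_apply_eq_comp]

lemma opTensor_one : opTensor (1 : Fock H →L[ℂ] Fock H) (1 : Fock K →L[ℂ] Fock K) = 1 :=
  Composite.ext fun x y => by simp only [opTensor_tmul, one_apply_eq_self]

lemma opTensor_star (A : Fock H →L[ℂ] Fock H) (B : Fock K →L[ℂ] Fock K) :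
    star (opTensor A B) = opTensor (star A) (star B) := by
  refine Composite.ext fun x y => ext_inner_left ℂ fun z => ?_
  rw [opTensor_tmul, ContinuousLinearMap.star_eq_adjoint, ContinuousLinearMap.adjoint_inner_right]
  induction z using Composite.denseRange_incl.induction_on with
  | hp => exact isClosed_eq (by fun_prop) (by fun_prop)
  | ih z =>
    induction z using TensorProduct.induction_on with
    | zero => simp
    | tmul x' y' =>
      rw [opTensor_tmul, LinearIsometry.inner_map_map, LinearIsometry.inner_map_map,
        TensorProduct.inner_tmul, TensorProduct.inner_tmul, ContinuousLinearMap.star_eq_adjoint,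
        ContinuousLinearMap.star_eq_adjoint, ContinuousLinearMap.adjoint_inner_right,
        ContinuousLinearMap.adjoint_inner_right]
    | add x y hx hy =>
      rw [map_add, map_add, inner_add_left, inner_add_left, hx, hy]

variable (H K) in
/-- The C*-tensor product of the two CAR algebras, acting on the composite Fock space. -/
def tensorAlgebra : StarSubalgebra ℂ (Composite H K →L[ℂ] Composite H K) :=
  (StarAlgebra.adjoin ℂ {X | ∃ A ∈ carAlgebra H, ∃ B ∈ carAlgebra K, X = opTensor A B}).topologicalClosure

lemma opTensor_mem {A : Fock H →L[ℂ] Fock H} {B : Fock K →L[ℂ] Fock K} (hA : A ∈ carAlgebra H)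
    (hB : B ∈ carAlgebra K) : opTensor A B ∈ tensorAlgebra H K :=
  StarSubalgebra.le_topologicalClosure _ (StarAlgebra.subset_adjoin ℂ _ ⟨A, hA, B, hB, rfl⟩)

/-- The operator `x ↦ x ⊗ y`. -/
def tensorRight (y : Fock K) : Fock H →L[ℂ] Composite H K :=
  (Composite.incl H K).toContinuousLinearMap ∘L (TensorProduct.mkL ℂ (Fock H) (Fock K)).flip y

lemma tensorRight_apply (x : Fock H) (y : Fock K) :
    tensorRight y x = Composite.incl H K (x ⊗ₜ y) := rfl

/-- The slice `X ↦ (id ⊗ ⟪y, · y'⟫)(X)`, that is, `⟪x, slice y y' X x'⟫ = ⟪x ⊗ y, X (x' ⊗ y')⟫`. -/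
def slice (y y' : Fock K) (X : Composite H K →L[ℂ] Composite H K) : Fock H →L[ℂ] Fock H :=
  (tensorRight y).adjoint ∘L X ∘L tensorRight y'

lemma tensorRight_adjoint_tmul (y z : Fock K) (x : Fock H) :
    (tensorRight y).adjoint (Composite.incl H K (x ⊗ₜ z)) =
      ⟪y, z⟫_ℂ • x := by
  refine ext_inner_left ℂ fun w => ?_
  rw [ContinuousLinearMap.adjoint_inner_right, tensorRight_apply,
    LinearIsometry.inner_map_map, TensorProduct.inner_tmul, inner_smul_right, mul_comm]

lemma slice_opTensor (y y' : Fock K) (A : Fock H →L[ℂ] Fock H) (B : Fock K →L[ℂ] Fock K) :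
    slice y y' (opTensor A B) = ⟪y, B y'⟫_ℂ • A := by
  ext x
  rw [slice, ContinuousLinearMap.comp_apply, ContinuousLinearMap.comp_apply, tensorRight_apply,
    opTensor_tmul, tensorRight_adjoint_tmul]
  rfl

lemma slice_star (y y' : Fock K) (X : Composite H K →L[ℂ] Composite H K) :
    slice y y' (star X) = star (slice y' y X) := by
  simp [slice, ContinuousLinearMap.star_eq_adjoint, ContinuousLinearMap.adjoint_comp,
    ContinuousLinearMap.comp_assoc]

lemma slice_mul [FiniteDimensional ℂ K] (y y' : Fock K)
    (X Y : Composite H K →L[ℂ] Composite H K) :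
    slice y y' (X * Y) = ∑ i, slice y (stdOrthonormalBasis ℂ (Fock K) i) X *
      slice (stdOrthonormalBasis ℂ (Fock K) i) y' Y := by
  have h : (∑ i, tensorRight (H := H) (stdOrthonormalBasis ℂ (Fock K) i) ∘L
      (tensorRight (stdOrthonormalBasis ℂ (Fock K) i)).adjoint) = 1 := by
    refine Composite.ext fun x z => ?_
    simp only [sum_apply, ContinuousLinearMap.comp_apply,
      tensorRight_adjoint_tmul, map_smul, tensorRight_apply, one_apply_eq_self]
    conv_rhs => rw [← (stdOrthonormalBasis ℂ (Fock K)).sum_repr' z]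
    rw [TensorProduct.tmul_sum, map_sum]
    simp only [TensorProduct.tmul_smul, map_smul]
  have h2 : slice y y' (X * Y) = slice y y' (X * 1 * Y) := by rw [mul_one]
  rw [h2, ← h]
  ext x
  simp [slice, map_sum]

lemma slice_mem [FiniteDimensional ℂ K] (y y' : Fock K)
    {X : Composite H K →L[ℂ] Composite H K} (hX : X ∈ tensorAlgebra H K) :
    slice y y' X ∈ carAlgebra H := by
  have hc (y y' : Fock K) : Continuous (slice (H := H) y y') := by unfold slice; fun_prop
  have key : ∀ X ∈ StarAlgebra.adjoin ℂ
      {X | ∃ A ∈ carAlgebra H, ∃ B ∈ carAlgebra K, X = opTensor A B},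
      ∀ y y' : Fock K, slice y y' X ∈ carAlgebra H := by
    intro X hX
    induction hX using StarAlgebra.adjoin_induction with
    | mem X hX =>
      obtain ⟨A, hA, B, hB, rfl⟩ := hX
      intro y y'
      rw [slice_opTensor]
      exact SMulMemClass.smul_mem _ hA
    | algebraMap r =>
      intro y y'
      have : algebraMap ℂ (Composite H K →L[ℂ] Composite H K) r = opTensor (r • 1) 1 := by
        refine Composite.ext fun x y => ?_
        rw [opTensor_tmul, Algebra.algebraMap_eq_smul_one]
        change r • Composite.incl H K (x ⊗ₜ y) = Composite.incl H K ((r • x) ⊗ₜ y)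
        rw [← TensorProduct.smul_tmul', map_smul]
      rw [this, slice_opTensor]
      exact SMulMemClass.smul_mem _ (SMulMemClass.smul_mem _ (one_mem _))
    | add X Y _ _ hX hY =>
      intro y y'
      have : slice y y' (X + Y) = slice y y' X + slice y y' Y := by
        ext; simp [slice]
      rw [this]
      exact add_mem (hX _ _) (hY _ _)
    | mul X Y _ _ hX hY =>
      intro y y'
      rw [slice_mul]
      exact sum_mem fun i _ => mul_mem (hX _ _) (hY _ _)
    | star X _ hX =>
      intro y y'
      rw [slice_star]
      exact star_mem (hX _ _)
  exact closure_minimal (fun X hX => key X hX y y')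
    ((StarSubalgebra.isClosed_topologicalClosure _).preimage (hc y y')) hX

/-- The slice of an element of the tensor product algebra, as an element of the CAR algebra of the
first factor. -/
def algebraSlice [FiniteDimensional ℂ K] (y y' : Fock K) (X : tensorAlgebra H K) : carAlgebra H :=
  ⟨slice y y' X, slice_mem y y' X.2⟩

lemma algebraSlice_add [FiniteDimensional ℂ K] (y y' : Fock K) (X X' : tensorAlgebra H K) :
    algebraSlice y y' (X + X') = algebraSlice y y' X + algebraSlice y y' X' := by
  ext
  simp [algebraSlice, slice]

lemma algebraSlice_smul [FiniteDimensional ℂ K] (y y' : Fock K) (c : ℂ) (X : tensorAlgebra H K) :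
    algebraSlice y y' (c • X) = c • algebraSlice y y' X := by
  ext
  simp [algebraSlice, slice]

/-- The elementary tensor `A ⊗ B` as an element of the tensor product algebra. -/
def elemTensor (A : carAlgebra H) (B : carAlgebra K) : tensorAlgebra H K :=
  ⟨opTensor A B, opTensor_mem A.2 B.2⟩

lemma algebraSlice_elemTensor [FiniteDimensional ℂ K] (y y' : Fock K) (A : carAlgebra H)
    (B : carAlgebra K) : algebraSlice y y' (elemTensor A B) =
      ⟪y, (B : Fock K →L[ℂ] Fock K) y'⟫_ℂ • A := by
  ext1
  have h : (algebraSlice y y' (elemTensor A B) : Fock H →L[ℂ] Fock H) =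
      slice y y' (opTensor (A : Fock H →L[ℂ] Fock H) (B : Fock K →L[ℂ] Fock K)) := rfl
  rw [h, slice_opTensor]
  simp

/-- The product functional `ω ⊗ tr(ρ ·)`, with the trace over the second factor computed in an
orthonormal basis; see `productFunctional_elemTensor`. -/
def productFunctional [FiniteDimensional ℂ K] (ω : carAlgebra H →ₗ[ℂ] ℂ)
    (ρ : Fock K →L[ℂ] Fock K) : tensorAlgebra H K →ₗ[ℂ] ℂ where
  toFun X := ∑ i, ω (algebraSlice (stdOrthonormalBasis ℂ (Fock K) i)
    (ρ (stdOrthonormalBasis ℂ (Fock K) i)) X)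
  map_add' X Y := by
    simp only [algebraSlice_add, map_add, Finset.sum_add_distrib]
  map_smul' c X := by
    simp only [algebraSlice_smul, map_smul, Finset.smul_sum, RingHom.id_apply]

/-- The expectation `tr(ρ A)`. -/
def traceState (ρ : Fock K →L[ℂ] Fock K) (A : carAlgebra K) : ℂ :=
  LinearMap.trace ℂ (Fock K) (ρ * (A : Fock K →L[ℂ] Fock K)).toLinearMap

/-- `(ω ⊗ ρ)(A ⊗ B) = ω(A) tr(ρ B)`. -/
lemma productFunctional_elemTensor [FiniteDimensional ℂ K] (ω : carAlgebra H →ₗ[ℂ] ℂ)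
    (ρ : Fock K →L[ℂ] Fock K) (A : carAlgebra H) (B : carAlgebra K) :
    productFunctional ω ρ (elemTensor A B) = ω A * traceState ρ B := by
  rw [traceState, ContinuousLinearMap.toLinearMap_mul, LinearMap.trace_mul_comm,
    LinearMap.trace_eq_sum_inner _ (stdOrthonormalBasis ℂ (Fock K)), Finset.mul_sum]
  have h : productFunctional ω ρ (elemTensor A B) =
    ∑ i, ω (algebraSlice (stdOrthonormalBasis ℂ (Fock K) i)
      (ρ (stdOrthonormalBasis ℂ (Fock K) i)) (elemTensor A B)) := rfl
  rw [h]
  refine Finset.sum_congr rfl fun i _ => ?_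
  rw [algebraSlice_elemTensor, map_smul, smul_eq_mul, mul_comm]
  rfl

end Composite

section Model

/-- The one-particle space `ℓ²(ℤ)` of the reservoir. -/
abbrev ReservoirSpace : Type := lp (fun _ : ℤ => ℂ) 2

/-- The canonical basis vector `Ψ_j` of the reservoir. -/
def reservoirBasis (j : ℤ) : ReservoirSpace := lp.single 2 j 1

/-- The one-particle space `ℂ^d` of the sample. -/
abbrev SampleSpace (d : ℕ) : Type := EuclideanSpace ℂ (Fin d)

/-- The canonical basis vector `e_j` of the sample. -/
def sampleBasis {d : ℕ} (j : Fin d) : SampleSpace d := EuclideanSpace.single j 1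

lemma memℓp_comp_equiv (f : ReservoirSpace) (s : ℤ ≃ ℤ) :
    Memℓp (fun j : ℤ => (f (s j) : ℂ)) 2 := by
  have h := (memℓp_gen_iff (p := 2) (by norm_num)).1 (lp.memℓp f)
  exact memℓp_gen ((s.summable_iff (f := fun j => ‖f j‖ ^ (2 : ENNReal).toReal)).2 h)

lemma norm_comp_equiv (f : ReservoirSpace) (s : ℤ ≃ ℤ) :
    ‖(⟨fun j : ℤ => (f (s j) : ℂ), memℓp_comp_equiv f s⟩ : ReservoirSpace)‖ = ‖f‖ := by
  rw [lp.norm_eq_tsum_rpow (by norm_num), lp.norm_eq_tsum_rpow (by norm_num)]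
  congr 1
  exact s.tsum_eq (fun j => ‖f j‖ ^ (2 : ENNReal).toReal)

/-- The shift `S`, `(S f)(j) = f (j + 1)`, that is, `S Ψ_j = Ψ_{j-1}`. -/
def shift : ReservoirSpace ≃ₗᵢ[ℂ] ReservoirSpace where
  toFun f := ⟨fun j : ℤ => f (j + 1), memℓp_comp_equiv f (Equiv.addRight 1)⟩
  invFun f := ⟨fun j : ℤ => f (j - 1), memℓp_comp_equiv f (Equiv.subRight 1)⟩
  left_inv f := by ext j; exact congrArg f (sub_add_cancel j 1)
  right_inv f := by ext j; exact congrArg f (add_sub_cancel_right j 1)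
  map_add' f g := rfl
  map_smul' c f := rfl
  norm_map' f := norm_comp_equiv f (Equiv.addRight 1)

lemma shift_reservoirBasis (j : ℤ) : shift (reservoirBasis j) = reservoirBasis (j - 1) := by
  ext i
  change (reservoirBasis j : ∀ _, ℂ) (i + 1) = (reservoirBasis (j - 1) : ∀ _, ℂ) i
  simp only [reservoirBasis, lp.coeFn_single, Pi.single_apply, eq_sub_iff_add_eq]

variable {d : ℕ}

/-- The coupling `K = exp[-iα (b₀* ⊗ a₀ + b₀ ⊗ a₀*)]`. -/
def coupling (d : ℕ) [NeZero d] (α : ℝ) :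
    Composite ReservoirSpace (SampleSpace d) →L[ℂ] Composite ReservoirSpace (SampleSpace d) :=
  NormedSpace.exp ((-Complex.I * (α : ℂ)) •
    (opTensor (create (reservoirBasis 0)) (annihilate (sampleBasis (0 : Fin d))) +
      opTensor (annihilate (reservoirBasis 0)) (create (sampleBasis (0 : Fin d)))))

/-- The free one time step evolution `U_F = Γ(S) ⊗ Γ(W)`. -/
def freeEvolution (W : SampleSpace d ≃ₗᵢ[ℂ] SampleSpace d) :
    Composite ReservoirSpace (SampleSpace d) →L[ℂ] Composite ReservoirSpace (SampleSpace d) :=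
  opTensor (secondQuant shift) (secondQuant W)

/-- The one time step evolution operator `U = U_F K`. -/
def stepOperator [NeZero d] (α : ℝ) (W : SampleSpace d ≃ₗᵢ[ℂ] SampleSpace d) :
    Composite ReservoirSpace (SampleSpace d) →L[ℂ] Composite ReservoirSpace (SampleSpace d) :=
  freeEvolution W * coupling d α

lemma coupling_mem [NeZero d] (α : ℝ) : coupling d α ∈ tensorAlgebra ReservoirSpace (SampleSpace d) := by
  rw [coupling, NormedSpace.exp_eq_tsum ℂ]
  refine tsum_mem (StarSubalgebra.isClosed_topologicalClosure _) fun n =>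
    SMulMemClass.smul_mem _ (pow_mem ?_ n)
  exact SMulMemClass.smul_mem _ (add_mem (opTensor_mem (create_mem _) (annihilate_mem _))
    (opTensor_mem (annihilate_mem _) (create_mem _)))

lemma freeEvolution_unitary (W : SampleSpace d ≃ₗᵢ[ℂ] SampleSpace d) :
    freeEvolution W ∈ unitary (Composite ReservoirSpace (SampleSpace d) →L[ℂ]
      Composite ReservoirSpace (SampleSpace d)) := by
  have h1 := Unitary.mem_iff.1 (secondQuant_unitary shift)
  have h2 := Unitary.mem_iff.1 (secondQuant_unitary W)
  rw [Unitary.mem_iff, freeEvolution, opTensor_star, opTensor_mul, opTensor_mul, h1.1, h1.2, h2.1,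
    h2.2]
  exact ⟨opTensor_one, opTensor_one⟩

lemma freeEvolution_conj_mem (W : SampleSpace d ≃ₗᵢ[ℂ] SampleSpace d)
    {X : Composite ReservoirSpace (SampleSpace d) →L[ℂ] Composite ReservoirSpace (SampleSpace d)}
    (hX : X ∈ tensorAlgebra ReservoirSpace (SampleSpace d)) :
    star (freeEvolution W) * X * freeEvolution W ∈
      tensorAlgebra ReservoirSpace (SampleSpace d) := by
  refine conj_mem_of_adjoin (freeEvolution_unitary W)
    (StarSubalgebra.isClosed_topologicalClosure _) ?_ hX
  rintro _ ⟨A, hA, B, hB, rfl⟩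
  rw [freeEvolution, opTensor_star, opTensor_mul, opTensor_mul]
  exact opTensor_mem (secondQuant_conj_mem _ hA) (secondQuant_conj_mem _ hB)

lemma evolve_mem [NeZero d] (α : ℝ) (W : SampleSpace d ≃ₗᵢ[ℂ] SampleSpace d) (t : ℕ)
    {X : Composite ReservoirSpace (SampleSpace d) →L[ℂ] Composite ReservoirSpace (SampleSpace d)}
    (hX : X ∈ tensorAlgebra ReservoirSpace (SampleSpace d)) :
    (stepOperator α W).adjoint ^ t * X * stepOperator α W ^ t ∈
      tensorAlgebra ReservoirSpace (SampleSpace d) := by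
  rw [← ContinuousLinearMap.star_eq_adjoint]
  induction t with
  | zero => simpa using hX
  | succ t ih =>
    have h := mul_mem (mul_mem (star_mem (coupling_mem (d := d) α)) (freeEvolution_conj_mem W ih))
      (coupling_mem (d := d) α)
    rw [pow_succ', pow_succ]
    generalize star (stepOperator α W) ^ t = Q at h ⊢
    generalize stepOperator α W ^ t = P at h ⊢
    rw [stepOperator, star_mul]
    simpa only [mul_assoc] using h

/-- The evolution `τ^t(X) = U^{*t} X U^t` of observables. -/
def evolve [NeZero d] (α : ℝ) (W : SampleSpace d ≃ₗᵢ[ℂ] SampleSpace d) (t : ℕ)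
    (X : tensorAlgebra ReservoirSpace (SampleSpace d)) :
    tensorAlgebra ReservoirSpace (SampleSpace d) :=
  ⟨(stepOperator α W).adjoint ^ t * X * stepOperator α W ^ t, evolve_mem α W t X.2⟩

/-- The time-evolved state of the sample, `ρ_t(A) = (ω ⊗ ρ)(τ^t(1 ⊗ A))`. -/
def sampleState [NeZero d] (α : ℝ) (W : SampleSpace d ≃ₗᵢ[ℂ] SampleSpace d)
    (ω : carAlgebra ReservoirSpace →ₗ[ℂ] ℂ)
    (ρ : Fock (SampleSpace d) →L[ℂ] Fock (SampleSpace d)) (t : ℕ)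
    (A : carAlgebra (SampleSpace d)) : ℂ :=
  productFunctional ω ρ (evolve α W t (elemTensor 1 A))

/-- The one-body density matrix, with entries `⟨e_j, ρ⁽¹⁾ e_k⟩ = f(a_k* a_j)` of a functional on
the observables of the sample. -/
def oneBodyMatrix (f : carAlgebra (SampleSpace d) → ℂ) : Matrix (Fin d) (Fin d) ℂ :=
  Matrix.of fun j k => f (creator (sampleBasis k) * annihilator (sampleBasis j))

/-- Density matrices: positive operators of trace one. -/
def IsDensityMatrix (ρ : Fock (SampleSpace d) →L[ℂ] Fock (SampleSpace d)) : Prop :=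
  ρ.IsPositive ∧ LinearMap.trace ℂ (Fock (SampleSpace d)) ρ.toLinearMap = 1

/-- The matrix of `W` in the canonical basis. -/
def matrixOf (W : SampleSpace d ≃ₗᵢ[ℂ] SampleSpace d) : Matrix (Fin d) (Fin d) ℂ :=
  Matrix.of fun j k => ⟪sampleBasis j, W (sampleBasis k)⟫_ℂ

/-- `𝕄 = W (1 + (cos α - 1) |e₀⟩⟨e₀|)`. -/
def matM [NeZero d] (α : ℝ) (W : SampleSpace d ≃ₗᵢ[ℂ] SampleSpace d) : Matrix (Fin d) (Fin d) ℂ :=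
  matrixOf W * (1 + ((Real.cos α - 1 : ℝ) : ℂ) • Matrix.single 0 0 1)

/-- `𝔹 = σ sin² α W |e₀⟩⟨e₀| W*`. -/
def matB [NeZero d] (σ α : ℝ) (W : SampleSpace d ≃ₗᵢ[ℂ] SampleSpace d) : Matrix (Fin d) (Fin d) ℂ :=
  matrixOf W * (((σ * Real.sin α ^ 2 : ℝ) : ℂ) • Matrix.single 0 0 1) * (matrixOf W).conjTranspose

end Model

end FermionicWalk

end

noncomputable section
namespace FermionicWalk

/-! ### Algebra of an exchange Hamiltonian between two commuting fermionic modes. -/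

section Abstract

/-! The interaction is quadratic, so the dynamics should reduce to a linear map on one-particle
space. The obstacle is that operators of the sample and of the reservoir commute instead of
anticommuting: with `h = b₀* ⊗ a₀ + b₀ ⊗ a₀*`, the commutator of `h` with `1 ⊗ a₀` contains a cubic
term, and `K* (1 ⊗ a₀) K` is not a combination of annihilators. The anticommutator is, however,
linear: `h a + a h = b` and `h a h = 0`, writing `a`, `b` for the two annihilators. Hence `K D K`,
with `K` on both sides, is again of the form `D(u) = c(u₁) ⊗ 1 + 1 ⊗ c(u₂)`
(`exp_exchange_conj_pairAnnih`).

Only gauge-invariant products `D(u)* D(w)` are needed, and for them the two-sided `K` is harmless: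
since `K* K = 1` and `F F* = 1` for the free evolution `F`, the observable `U* D(u)* D(w) U` equals
`(K F* D(u) F K)* (K F* D(w) F K)`. So such products evolve through an explicit one-particle map `Q`
(`stepOperator_conj`, `evolve_pairAnnihilator`). The map `Q` moves the reservoir sites up by one and
deposits a new amplitude at site `0`.

The initial state gives `D(u)* D(w)` the value `σ ⟨w₁, u₁⟩ + tr(ρ a*(u₂) a(w₂))`
(`twoPointForm_eq`). Writing `Q^(t+1) (0, e_k) = Q^t (Q (0, e_k))`, the vector `Q (0, e_k)` splits
into a multiple of `Ψ₀` and a combination of the `(0, e_l)` with coefficients from `𝕄`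
(`oneParticleStep_sampleBasis`). Then `Q^t` sends `Ψ₀` to `Ψ_t`, whereas the reservoir part of `Q^t
(0, v)` vanishes at site `t`: a fresh reservoir site is uncorrelated with what came before. The
cross terms drop out, the sample terms give `𝕄 ρ_t 𝕄*`, and the `Ψ_t` term gives `𝔹`. -/

lemma exp_smul_of_cube_eq {A : Type*} [NormedRing A] [NormedAlgebra ℂ A] [CompleteSpace A]
    {h : A} (hh : h * h * h = h) (z : ℂ) :
    NormedSpace.exp (z • h) = 1 + Complex.sinh z • h + (Complex.cosh z - 1) • (h * h) := by
  -- Spectral decomposition: `h` has eigenvalues `1`, `-1`, `0` with projections `(h² + h)/2`, `(h²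
  -- - h)/2`, `1 - h²`; the last contributes only to the zeroth power.
  have hpow : ∀ n : ℕ, h ^ n = (1 / 2 : ℂ) • (h * h + h) + ((-1) ^ n * (1 / 2) : ℂ) • (h * h - h) +
      if n = 0 then 1 - h * h else 0 := by
    intro n
    induction n with
    | zero => simp only [pow_zero, one_mul, if_true]; module
    | succ n ih =>
      rw [pow_succ, ih, if_neg n.succ_ne_zero, add_zero]
      split_ifs <;> simp only [add_mul, smul_mul_assoc, sub_mul, hh, one_mul, zero_mul] <;>
        rw [pow_succ] <;> module
  have hs (w : ℂ) : HasSum (fun n : ℕ => (n.factorial : ℂ)⁻¹ * w ^ n) (Complex.exp w) := by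
    simpa [Complex.exp_eq_exp_ℂ] using NormedSpace.exp_series_hasSum_exp' (𝕂 := ℂ) w
  have h1 := (((hs z).mul_right (1 / 2)).smul_const (h * h + h)).add
    (((hs (-z)).mul_right (1 / 2)).smul_const (h * h - h)) |>.add
    (hasSum_ite_eq 0 (1 - h * h))
  have h2 := NormedSpace.exp_series_hasSum_exp' (𝕂 := ℂ) (z • h)
  refine h2.unique ?_
  convert h1 using 1
  · funext n
    rw [smul_pow, hpow]
    split_ifs with hn
    · subst hn; simp only [pow_zero, Nat.factorial_zero, Nat.cast_one]; module
    · rw [neg_pow]; module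
  · rw [Complex.sinh, Complex.cosh]; module

/-- The relations between two commuting fermionic modes, with annihilators `a`, `b` and creators
`a'`, `b'`. -/
structure ModePair {A : Type*} [Ring A] (a a' b b' : A) : Prop where
  sq : a * a = 0
  sq' : a' * a' = 0
  sqb : b * b = 0
  sqb' : b' * b' = 0
  anti : a * a' = 1 - a' * a
  antib : b * b' = 1 - b' * b
  comm : a * b = b * a
  comm' : a * b' = b' * a
  commb : a' * b = b * a'
  commb' : a' * b' = b' * a'

/-- `h` moves a particle between the modes, and `h * h` is the projection onto the states with
exactly one of them occupied; this is behind the cubic identity. All four identities follow by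
normal ordering. -/
lemma ModePair.relations {A : Type*} [Ring A] {a a' b b' h : A} (m : ModePair a a' b b')
    (hh : h = b' * a + b * a') :
    h * h * h = h ∧ h * a + a * h = b ∧ h * a * h = 0 ∧ h * h * a + a * (h * h) = a := by
  -- Lets each relation act inside a right-associated product.
  have r {x y w : A} (h : x * y = w) (z : A) : x * (y * z) = w * z := by rw [← mul_assoc, h]
  subst hh
  refine ⟨?_, ?_, ?_, ?_⟩ <;>
    simp only [mul_add, add_mul, mul_sub, sub_mul, mul_assoc, m.sq, m.anti, m.comm,
      m.commb, r m.sq', r m.sqb, r m.sqb', r m.anti, r m.antib, r m.comm, r m.comm', r m.commb,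
      r m.commb', mul_zero, zero_mul, mul_one, one_mul] <;>
    abel

variable {A : Type*} [Ring A] [Algebra ℂ A] {a a' b b' : A}

lemma ModePair.conj (m : ModePair a a' b b') {h k : A} (hh : h = b' * a + b * a') {x y : ℂ}
    (hk : k = 1 + x • h + y • (h * h)) : k * a * k = (1 + y) • a + x • b := by
  obtain ⟨-, e1, e2, e3⟩ := m.relations hh
  have e4 : h * h * a * h = 0 := by rw [mul_assoc, mul_assoc, ← mul_assoc h a h, e2, mul_zero]
  have e5 : h * a * (h * h) = 0 := by rw [← mul_assoc, e2, zero_mul]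
  have e6 : h * h * a * (h * h) = 0 := by rw [← mul_assoc, e4, zero_mul]
  calc k * a * k = a + x • (h * a + a * h) + y • (h * h * a + a * (h * h)) + (x * x) • (h * a * h)
        + (x * y) • (h * h * a * h) + (x * y) • (h * a * (h * h)) +
        (y * y) • (h * h * a * (h * h)) := by
        subst hk
        simp only [mul_add, add_mul, smul_mul_assoc, mul_smul_comm, one_mul, mul_one]
        module
    _ = _ := by rw [e1, e2, e3, e4, e5, e6]; module

/-- Moving `c` through `k` flips the sign of `x`, and the condition on `x` and `y` says exactly that
the flipped element is a left inverse of `k`. -/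
lemma conj_of_anticomm {h k c : A} (hh : h * h * h = h) (hc : h * c = -(c * h)) {x y : ℂ}
    (hxy : x * x = 2 * y + y * y) (hk : k = 1 + x • h + y • (h * h)) : k * c * k = c := by
  have h1 : k * c = c * (1 - x • h + y • (h * h)) := by
    have : h * h * c = c * (h * h) := by
      rw [mul_assoc, hc, mul_neg, ← mul_assoc, hc, neg_mul, neg_neg, mul_assoc]
    subst hk
    simp only [mul_add, add_mul, mul_sub, smul_mul_assoc, mul_smul_comm, one_mul, mul_one, hc, this]
    module
  have h2 : (1 - x • h + y • (h * h)) * k = 1 + (2 * y + y * y - x * x) • (h * h) := by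
    subst hk
    simp only [mul_add, add_mul, sub_mul, smul_mul_assoc, mul_smul_comm, one_mul, mul_one, hh,
      ← mul_assoc]
    module
  rw [h1, mul_assoc, h2, hxy, sub_self, zero_smul, add_zero, mul_one]

end Abstract

/-! ### Canonical anticommutation relations on the Fock space. -/

section FockOperators

variable {H : Type*} [NormedAddCommGroup H] [InnerProductSpace ℂ H]

lemma create_add (φ ψ : H) : create (φ + ψ) = create φ + create ψ := by
  refine Fock.ext fun x => ?_
  simp [create_incl, add_mul]

lemma create_smul (c : ℂ) (φ : H) : create (c • φ) = c • create φ := by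
  refine Fock.ext fun x => ?_
  simp [create_incl]

lemma star_create (φ : H) : star (create φ) = annihilate φ := rfl

lemma star_annihilate (φ : H) : star (annihilate φ) = create φ := by
  rw [← star_create, star_star]

lemma annihilate_add (φ ψ : H) : annihilate (φ + ψ) = annihilate φ + annihilate ψ := by
  simp only [← star_create, create_add, star_add]

lemma annihilate_smul (c : ℂ) (φ : H) : annihilate (c • φ) = star c • annihilate φ := by
  simp only [← star_create, create_smul, star_smul]

/-- Identifies the abstract adjoint with contraction on the dense exterior algebra, so that the
anticommutation relations reduce to algebra there. -/
lemma annihilate_incl (φ : H) (x : ExteriorAlgebra ℂ H) :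
    annihilate φ (Fock.incl H x) = Fock.incl H (annih φ x) := by
  refine ext_inner_left ℂ fun y => ?_
  rw [annihilate, ContinuousLinearMap.adjoint_inner_right]
  induction y using Fock.denseRange_incl.induction_on with
  | hp => exact isClosed_eq (by fun_prop) (by fun_prop)
  | ih y =>
    rw [create_incl, LinearIsometry.inner_map_map, LinearIsometry.inner_map_map, inner_ι_mul_left]

lemma create_mul_create (φ ψ : H) : create φ * create ψ = -(create ψ * create φ) := by
  refine Fock.ext fun x => ?_
  have h := eq_neg_of_add_eq_zero_left (ExteriorAlgebra.ι_add_mul_swap (R := ℂ) φ ψ)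
  rw [mul_apply_eq_comp, neg_apply, mul_apply_eq_comp, create_incl, create_incl, create_incl,
    create_incl, ← mul_assoc, h, neg_mul, mul_assoc, map_neg]

lemma annihilate_mul_annihilate (φ ψ : H) :
    annihilate φ * annihilate ψ = -(annihilate ψ * annihilate φ) := by
  simp only [← star_create, ← star_mul, create_mul_create ψ φ, star_neg]

lemma annihilate_mul_create (φ ψ : H) :
    annihilate φ * create ψ = ⟪φ, ψ⟫_ℂ • 1 - create ψ * annihilate φ := by
  refine Fock.ext fun x => ?_
  simp [create_incl, annihilate_incl, annih_ι_mul]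

lemma create_mul_self (φ : H) : create φ * create φ = 0 := by
  refine Fock.ext fun x => ?_
  rw [mul_apply_eq_comp, create_incl, create_incl, ← mul_assoc, ExteriorAlgebra.ι_sq_zero]
  simp

lemma annihilate_mul_self (φ : H) : annihilate φ * annihilate φ = 0 := by
  rw [← star_create, ← star_mul, create_mul_self, star_zero]

lemma star_secondQuant_mul_annihilate (V : H ≃ₗᵢ[ℂ] H) (φ : H) :
    star (secondQuant V) * annihilate φ * secondQuant V = annihilate (V.symm φ) := by
  have h := secondQuant_create V (V.symm φ)
  rw [V.apply_symm_apply] at h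
  have h2 := congrArg star h
  rw [star_mul, star_mul, star_create, star_create] at h2
  rw [← h2, mul_assoc, (Unitary.mem_iff.1 (secondQuant_unitary V)).1, mul_one]

end FockOperators

/-! ### Conjugation of paired annihilators by the coupling and by the free evolution. -/

section CompositeOperators

variable {H K : Type*} [NormedAddCommGroup H] [InnerProductSpace ℂ H]
  [NormedAddCommGroup K] [InnerProductSpace ℂ K]

lemma opTensor_add_left (A A' : Fock H →L[ℂ] Fock H) (B : Fock K →L[ℂ] Fock K) :
    opTensor (A + A') B = opTensor A B + opTensor A' B :=
  Composite.ext fun x y => by simp [opTensor_tmul, TensorProduct.add_tmul]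

lemma opTensor_add_right (A : Fock H →L[ℂ] Fock H) (B B' : Fock K →L[ℂ] Fock K) :
    opTensor A (B + B') = opTensor A B + opTensor A B' :=
  Composite.ext fun x y => by simp [opTensor_tmul, TensorProduct.tmul_add]

lemma opTensor_smul_left (c : ℂ) (A : Fock H →L[ℂ] Fock H) (B : Fock K →L[ℂ] Fock K) :
    opTensor (c • A) B = c • opTensor A B :=
  Composite.ext fun x y => by simp [opTensor_tmul, ← TensorProduct.smul_tmul']

lemma opTensor_smul_right (c : ℂ) (A : Fock H →L[ℂ] Fock H) (B : Fock K →L[ℂ] Fock K) :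
    opTensor A (c • B) = c • opTensor A B :=
  Composite.ext fun x y => by simp [opTensor_tmul]

/-- The sum `c(u) ⊗ 1 + 1 ⊗ c(v)` of annihilation operators on the composite system. -/
def pairAnnih (u : H × K) : Composite H K →L[ℂ] Composite H K :=
  opTensor (annihilate u.1) 1 + opTensor 1 (annihilate u.2)

lemma pairAnnih_add (u w : H × K) : pairAnnih (u + w) = pairAnnih u + pairAnnih w := by
  simp only [pairAnnih, Prod.fst_add, Prod.snd_add, annihilate_add, opTensor_add_left,
    opTensor_add_right]
  abel

lemma pairAnnih_smul (c : ℂ) (u : H × K) : pairAnnih (c • u) = star c • pairAnnih u := by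
  simp only [pairAnnih, Prod.smul_fst, Prod.smul_snd, annihilate_smul, opTensor_smul_left,
    opTensor_smul_right, smul_add]

lemma pairAnnih_mem (u : H × K) : pairAnnih u ∈ tensorAlgebra H K :=
  add_mem (opTensor_mem (annihilate_mem _) (one_mem _))
    (opTensor_mem (one_mem _) (annihilate_mem _))

/-- The exchange operator `c*(φ) ⊗ c(e) + c(φ) ⊗ c*(e)`. -/
def exchange (φ : H) (e : K) : Composite H K →L[ℂ] Composite H K :=
  opTensor (create φ) (annihilate e) + opTensor (annihilate φ) (create e)

/-- Operators on different tensor factors commute; normalisation of the vectors makes the scalar in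
each anticommutator equal to `1`. -/
lemma modePair_opTensor {φ : H} {e : K} (hφ : ‖φ‖ = 1) (he : ‖e‖ = 1) :
    ModePair (opTensor (1 : Fock H →L[ℂ] Fock H) (annihilate e)) (opTensor 1 (create e))
      (opTensor (annihilate φ) (1 : Fock K →L[ℂ] Fock K)) (opTensor (create φ) 1) := by
  have z1 : opTensor (0 : Fock H →L[ℂ] Fock H) (1 : Fock K →L[ℂ] Fock K) = 0 := by
    simpa using opTensor_smul_left 0 (0 : Fock H →L[ℂ] Fock H) (1 : Fock K →L[ℂ] Fock K)
  have z2 : opTensor (1 : Fock H →L[ℂ] Fock H) (0 : Fock K →L[ℂ] Fock K) = 0 := by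
    simpa using opTensor_smul_right 0 (1 : Fock H →L[ℂ] Fock H) (0 : Fock K →L[ℂ] Fock K)
  have c1 := annihilate_mul_create φ φ
  have c2 := annihilate_mul_create e e
  rw [inner_self_eq_norm_sq_to_K, hφ] at c1
  rw [inner_self_eq_norm_sq_to_K, he] at c2
  constructor
  any_goals simp only [opTensor_mul, one_mul, mul_one, annihilate_mul_self, create_mul_self, z1, z2]
  · rw [eq_sub_iff_add_eq, ← opTensor_add_right, c2, ← opTensor_one]
    simp
  · rw [eq_sub_iff_add_eq, ← opTensor_add_left, c1, ← opTensor_one]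
    simp

lemma exchange_eq (φ : H) (e : K) : exchange φ e =
    opTensor (create φ) 1 * opTensor 1 (annihilate e) +
      opTensor (annihilate φ) 1 * opTensor 1 (create e) := by
  simp only [exchange, opTensor_mul, one_mul, mul_one]

/-- Only the second tensor factors matter, and there orthogonality removes the scalar from the
anticommutator of `c(v)` with `c*(e)`. -/
lemma exchange_anticomm_right (φ : H) (e v : K) (hv : ⟪v, e⟫_ℂ = 0) :
    exchange φ e * opTensor 1 (annihilate v) = -(opTensor 1 (annihilate v) * exchange φ e) := by
  have h1 := annihilate_mul_annihilate e v
  have h2 := annihilate_mul_create v e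
  rw [hv, zero_smul, zero_sub] at h2
  rw [eq_neg_iff_add_eq_zero, exchange, add_mul, mul_add]
  simp only [opTensor_mul, one_mul, mul_one]
  rw [h1, h2, ← neg_one_smul ℂ (annihilate v * annihilate e), ← neg_one_smul ℂ (create e * _),
    opTensor_smul_right, opTensor_smul_right]
  module

lemma exchange_anticomm_left (φ ψ : H) (e : K) (hψ : ⟪ψ, φ⟫_ℂ = 0) :
    exchange φ e * opTensor (annihilate ψ) 1 = -(opTensor (annihilate ψ) 1 * exchange φ e) := by
  have h1 := annihilate_mul_annihilate φ ψ
  have h2 := annihilate_mul_create ψ φ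
  rw [hψ, zero_smul, zero_sub] at h2
  rw [eq_neg_iff_add_eq_zero, exchange, add_mul, mul_add]
  simp only [opTensor_mul, one_mul, mul_one]
  rw [h1, h2, ← neg_one_smul ℂ (annihilate ψ * annihilate φ), ← neg_one_smul ℂ (create φ * _),
    opTensor_smul_left, opTensor_smul_left]
  module

lemma exp_exchange {φ : H} {e : K} (hφ : ‖φ‖ = 1) (he : ‖e‖ = 1) (α : ℝ) :
    NormedSpace.exp ((-Complex.I * (α : ℂ)) • exchange φ e) =
      1 + (-Complex.I * Real.sin α) • exchange φ e +
        ((Real.cos α - 1 : ℝ) : ℂ) • (exchange φ e * exchange φ e) := by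
  have h : -Complex.I * (α : ℂ) = (-α : ℂ) * Complex.I := by ring
  rw [exp_smul_of_cube_eq ((modePair_opTensor hφ he).relations (exchange_eq φ e)).1, h,
    Complex.sinh_mul_I, Complex.cosh_mul_I]
  simp [mul_comm]

/-- The exponential stands on both sides, without an adjoint, because it is the anticommutator with
the exchange operator that stays linear in the annihilators. Only the component of `u.2` along `e`
is affected; everything else anticommutes with the exchange operator and is fixed. -/
lemma exp_exchange_conj_pairAnnih {φ : H} {e : K} (hφ : ‖φ‖ = 1) (he : ‖e‖ = 1) (α : ℝ) (u : H × K)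
    (hu : ⟪u.1, φ⟫_ℂ = 0) :
    NormedSpace.exp ((-Complex.I * (α : ℂ)) • exchange φ e) * pairAnnih u *
        NormedSpace.exp ((-Complex.I * (α : ℂ)) • exchange φ e) =
      pairAnnih (u.1 + (Complex.I * Real.sin α * ⟪e, u.2⟫_ℂ) • φ,
        u.2 + (((Real.cos α - 1 : ℝ) : ℂ) * ⟪e, u.2⟫_ℂ) • e) := by
  have hm := modePair_opTensor hφ he
  have hcube := (hm.relations (exchange_eq φ e)).1
  have hk := exp_exchange hφ he α
  -- With `x = -i sin α` and `y = cos α - 1`, the condition of `conj_of_anticomm` is `sin² + cos² =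
  -- 1`.
  have hxy : (-Complex.I * Real.sin α) * (-Complex.I * Real.sin α) =
      2 * ((Real.cos α - 1 : ℝ) : ℂ) + ((Real.cos α - 1 : ℝ) : ℂ) * ((Real.cos α - 1 : ℝ) : ℂ) := by
    have h := Complex.sin_sq_add_cos_sq (α : ℂ)
    push_cast
    linear_combination Complex.sin (α : ℂ) ^ 2 * Complex.I_sq - h
  have hee : ⟪e, e⟫_ℂ = 1 := by simp [inner_self_eq_norm_sq_to_K, he]
  have ho : ⟪u.2 - ⟪e, u.2⟫_ℂ • e, e⟫_ℂ = 0 := by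
    rw [inner_sub_left, inner_smul_left, hee, inner_conj_symm, mul_one, sub_self]
  have k1 := conj_of_anticomm hcube (exchange_anticomm_left φ u.1 e hu) hxy hk
  have k2 := conj_of_anticomm hcube (exchange_anticomm_right φ e _ ho) hxy hk
  have k3 := hm.conj (exchange_eq φ e) hk
  generalize NormedSpace.exp ((-Complex.I * (α : ℂ)) • exchange φ e) = k at *
  -- The scalar comes out conjugated, since annihilators are antilinear in their argument. This also
  -- turns the coefficient `-i sin α` of the exponential into `+i sin α` inside the vector.
  have hdec : pairAnnih u = opTensor (annihilate u.1) 1 +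
      opTensor 1 (annihilate (u.2 - ⟪e, u.2⟫_ℂ • e)) +
      star ⟪e, u.2⟫_ℂ • opTensor 1 (annihilate e) := by
    rw [← opTensor_smul_right, ← annihilate_smul, add_assoc, ← opTensor_add_right,
      ← annihilate_add, sub_add_cancel, pairAnnih]
  rw [hdec]
  simp only [mul_add, add_mul, mul_smul_comm, smul_mul_assoc, k1, k2, k3]
  simp only [pairAnnih, sub_eq_add_neg, ← neg_smul, annihilate_add, annihilate_smul,
    opTensor_add_left, opTensor_add_right, opTensor_smul_left, opTensor_smul_right]
  simp only [star_mul', Complex.star_def, Complex.conj_I, Complex.conj_ofReal, star_neg]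
  module

lemma star_exchange (φ : H) (e : K) : star (exchange φ e) = exchange φ e := by
  rw [exchange, star_add, opTensor_star, opTensor_star, star_create, star_create, star_annihilate,
    star_annihilate, add_comm]

lemma exp_exchange_unitary (φ : H) (e : K) (α : ℝ) :
    NormedSpace.exp ((-Complex.I * (α : ℂ)) • exchange φ e) ∈
      unitary (Composite H K →L[ℂ] Composite H K) := by
  let _ : NormedAlgebra ℚ (Composite H K →L[ℂ] Composite H K) := NormedAlgebra.restrictScalars ℚ ℂ _
  refine NormedSpace.exp_mem_unitary_of_mem_skewAdjoint ?_
  rw [skewAdjoint.mem_iff, star_smul, star_exchange, ← neg_smul]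
  simp

lemma conj_opTensor_pairAnnih (V : H ≃ₗᵢ[ℂ] H) (W : K ≃ₗᵢ[ℂ] K) (u : H × K) :
    star (opTensor (secondQuant V) (secondQuant W)) * pairAnnih u *
      opTensor (secondQuant V) (secondQuant W) = pairAnnih (V.symm u.1, W.symm u.2) := by
  have h1 := (Unitary.mem_iff.1 (secondQuant_unitary V)).1
  have h2 := (Unitary.mem_iff.1 (secondQuant_unitary W)).1
  simp only [pairAnnih, opTensor_star, mul_add, add_mul, opTensor_mul, mul_one, h1, h2,
    star_secondQuant_mul_annihilate]

end CompositeOperators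

/-! ### The one-particle map and the support of its reservoir component. -/

section OneParticle

variable {d : ℕ}

lemma inner_reservoirBasis (j : ℤ) (f : ReservoirSpace) : ⟪reservoirBasis j, f⟫_ℂ = f j := by
  simp [reservoirBasis, lp.inner_single_left]

lemma norm_reservoirBasis (j : ℤ) : ‖reservoirBasis j‖ = 1 := by
  simp [reservoirBasis, lp.norm_single]

lemma reservoirBasis_apply (j i : ℤ) : reservoirBasis j i = if i = j then 1 else 0 := by
  simp [reservoirBasis, Pi.single_apply]

lemma norm_sampleBasis (j : Fin d) : ‖sampleBasis j‖ = 1 := by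
  simp [sampleBasis]

lemma shift_symm_apply (f : ReservoirSpace) (j : ℤ) : shift.symm f j = f (j - 1) := rfl

lemma shift_symm_reservoirBasis (j : ℤ) :
    shift.symm (reservoirBasis j) = reservoirBasis (j + 1) := by
  rw [LinearIsometryEquiv.symm_apply_eq, shift_reservoirBasis, add_sub_cancel_right]

variable [NeZero d]

/-- The one-particle map `Q` implementing the evolution of the operators `pairAnnih u`. -/
def oneParticleStep (α : ℝ) (W : SampleSpace d ≃ₗᵢ[ℂ] SampleSpace d) :
    ReservoirSpace × SampleSpace d →ₗ[ℂ] ReservoirSpace × SampleSpace d where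
  toFun u := (shift.symm u.1 +
      (Complex.I * Real.sin α * ⟪sampleBasis (0 : Fin d), W.symm u.2⟫_ℂ) • reservoirBasis 0,
    W.symm u.2 + (((Real.cos α - 1 : ℝ) : ℂ) * ⟪sampleBasis (0 : Fin d), W.symm u.2⟫_ℂ) •
      sampleBasis 0)
  map_add' u w := by
    simp only [Prod.fst_add, Prod.snd_add, map_add, inner_add_right, Prod.mk_add_mk]
    congr 1 <;> module
  map_smul' c u := by
    simp only [Prod.smul_fst, Prod.smul_snd, map_smul, inner_smul_right, RingHom.id_apply,
      Prod.smul_mk]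
    congr 1 <;> module

variable (d) in
/-- The one-particle vectors whose reservoir component is supported in `{0, 1, 2, …}`. -/
def forwardSpace : Submodule ℂ (ReservoirSpace × SampleSpace d) where
  carrier := {u | ∀ j < 0, u.1 j = 0}
  add_mem' hu hw j hj := by
    change _ + _ = (0 : ℂ)
    rw [hu j hj, hw j hj, add_zero]
  zero_mem' _ _ := rfl
  smul_mem' c u hu j hj := by
    change c * _ = (0 : ℂ)
    rw [hu j hj, mul_zero]

lemma oneParticleStep_fst_apply (α : ℝ) (W : SampleSpace d ≃ₗᵢ[ℂ] SampleSpace d)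
    (u : ReservoirSpace × SampleSpace d) {j : ℤ} (hj : j ≠ 0) :
    (oneParticleStep α W u).1 j = u.1 (j - 1) := by
  change shift.symm u.1 j + _ * reservoirBasis 0 j = _
  rw [reservoirBasis_apply, if_neg hj, mul_zero, add_zero, shift_symm_apply]

/-- The inverse shift moves amplitudes towards larger sites and the sample feeds site `0` only, so
negative sites stay empty. -/
lemma oneParticleStep_mem {α : ℝ} {W : SampleSpace d ≃ₗᵢ[ℂ] SampleSpace d}
    {u : ReservoirSpace × SampleSpace d} (hu : u ∈ forwardSpace d) :
    oneParticleStep α W u ∈ forwardSpace d := fun j hj => by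
  rw [oneParticleStep_fst_apply α W u hj.ne]
  exact hu _ (by omega)

lemma oneParticleStep_reservoirBasis (α : ℝ) (W : SampleSpace d ≃ₗᵢ[ℂ] SampleSpace d) (j : ℤ) :
    oneParticleStep α W (reservoirBasis j, 0) = (reservoirBasis (j + 1), 0) := by
  simp [oneParticleStep, shift_symm_reservoirBasis]

lemma oneParticleStep_pow_reservoirBasis (α : ℝ) (W : SampleSpace d ≃ₗᵢ[ℂ] SampleSpace d) (t : ℕ) :
    (oneParticleStep α W ^ t) (reservoirBasis 0, 0) = (reservoirBasis t, 0) := by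
  induction t with
  | zero => simp
  | succ t ih =>
    rw [pow_succ', Module.End.mul_apply, ih, oneParticleStep_reservoirBasis]
    push_cast
    rfl

/-- Amplitude enters at site `0` and advances by one site per step, so after `t` steps it has
reached site `t - 1` at most. The strict gap to site `t` is what decouples the fresh reservoir mode
in the recursion. -/
lemma oneParticleStep_pow_fst_apply (α : ℝ) (W : SampleSpace d ≃ₗᵢ[ℂ] SampleSpace d) (t : ℕ)
    (v : SampleSpace d) {j : ℤ} (hj : (t : ℤ) ≤ j) :
    ((oneParticleStep α W ^ t) (0, v)).1 j = 0 := by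
  induction t generalizing j with
  | zero => rfl
  | succ t ih =>
    push_cast at hj
    rw [pow_succ', Module.End.mul_apply, oneParticleStep_fst_apply α W _ (by omega)]
    exact ih (by omega)

end OneParticle

/-! ### Heisenberg evolution of quadratic observables. -/

section Evolution

variable {d : ℕ} [NeZero d]

lemma stepOperator_conj (α : ℝ) (W : SampleSpace d ≃ₗᵢ[ℂ] SampleSpace d)
    {u w : ReservoirSpace × SampleSpace d} (hu : u ∈ forwardSpace d) (hw : w ∈ forwardSpace d) :
    star (stepOperator α W) * (star (pairAnnih u) * pairAnnih w) * stepOperator α W =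
      star (pairAnnih (oneParticleStep α W u)) * pairAnnih (oneParticleStep α W w) := by
  have hF := (Unitary.mem_iff.1 (freeEvolution_unitary W)).2
  have hK : star (coupling d α) * coupling d α = 1 :=
    (Unitary.mem_iff.1 (exp_exchange_unitary _ _ α)).1
  have key {u : ReservoirSpace × SampleSpace d} (hu : u ∈ forwardSpace d) :
      coupling d α * (star (freeEvolution W) * pairAnnih u * freeEvolution W) * coupling d α =
        pairAnnih (oneParticleStep α W u) := by
    rw [freeEvolution, conj_opTensor_pairAnnih]
    refine exp_exchange_conj_pairAnnih (norm_reservoirBasis 0) (norm_sampleBasis 0) α _ ?_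
    -- After the inverse shift, the amplitude at site `0` is the former amplitude at site `-1`,
    -- which vanishes on `forwardSpace`.
    rw [← inner_conj_symm, inner_reservoirBasis, shift_symm_apply, hu _ (by norm_num), map_zero]
  rw [← key hu, ← key hw, stepOperator]
  generalize coupling d α = k at hK
  generalize freeEvolution W = f at hF
  -- Between the two conjugated annihilators stands `f (star k) k (star f)`, which collapses to `1`.
  have hF' := fun z => (mul_assoc f (star f) z).symm.trans (congrArg (· * z) hF)
  have hK' := fun z => (mul_assoc (star k) k z).symm.trans (congrArg (· * z) hK)
  simp only [star_mul, star_star, mul_assoc, hF', hK', one_mul]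

/-- The operator `pairAnnih u` as an element of the tensor product algebra. -/
def pairAnnihilator {H K : Type*} [NormedAddCommGroup H] [InnerProductSpace ℂ H]
    [NormedAddCommGroup K] [InnerProductSpace ℂ K] (u : H × K) : tensorAlgebra H K :=
  ⟨pairAnnih u, pairAnnih_mem u⟩

lemma evolve_pairAnnihilator (α : ℝ) (W : SampleSpace d ≃ₗᵢ[ℂ] SampleSpace d) (t : ℕ)
    {u w : ReservoirSpace × SampleSpace d} (hu : u ∈ forwardSpace d) (hw : w ∈ forwardSpace d) :
    evolve α W t (star (pairAnnihilator u) * pairAnnihilator w) =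
      star (pairAnnihilator ((oneParticleStep α W ^ t) u)) *
        pairAnnihilator ((oneParticleStep α W ^ t) w) := by
  apply Subtype.ext
  change star (stepOperator α W) ^ t * (star (pairAnnih u) * pairAnnih w) * stepOperator α W ^ t =
    star (pairAnnih ((oneParticleStep α W ^ t) u)) * pairAnnih ((oneParticleStep α W ^ t) w)
  induction t generalizing u w with
  | zero => simp
  | succ t ih =>
    have h := stepOperator_conj α W hu hw
    -- The powers are split so that the innermost conjugation comes off first; it replaces `u` and
    -- `w` by their images, hence the induction over all forward vectors.
    rw [pow_succ, pow_succ', pow_succ, Module.End.mul_apply, Module.End.mul_apply,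
      ← ih (oneParticleStep_mem hu) (oneParticleStep_mem hw), ← h]
    simp only [mul_assoc]

end Evolution

/-! ### Two-point function of the initial product state. -/

section TwoPoint

variable {d : ℕ} {ω : carAlgebra ReservoirSpace →ₗ[ℂ] ℂ}
  {ρ : Fock (SampleSpace d) →L[ℂ] Fock (SampleSpace d)}

lemma pairAnnihilator_eq {H K : Type*} [NormedAddCommGroup H] [InnerProductSpace ℂ H]
    [NormedAddCommGroup K] [InnerProductSpace ℂ K] (u : H × K) : pairAnnihilator u =
      elemTensor (annihilator u.1) 1 + elemTensor 1 (annihilator u.2) := rfl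

lemma elemTensor_mul {H K : Type*} [NormedAddCommGroup H] [InnerProductSpace ℂ H]
    [NormedAddCommGroup K] [InnerProductSpace ℂ K] (A A' : carAlgebra H) (B B' : carAlgebra K) :
    elemTensor A B * elemTensor A' B' = elemTensor (A * A') (B * B') :=
  Subtype.ext (opTensor_mul _ _ _ _)

lemma star_pairAnnihilator {H K : Type*} [NormedAddCommGroup H] [InnerProductSpace ℂ H]
    [NormedAddCommGroup K] [InnerProductSpace ℂ K] (u : H × K) : star (pairAnnihilator u) =
      elemTensor (creator u.1) 1 + elemTensor 1 (creator u.2) := by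
  apply Subtype.ext
  change star (opTensor (annihilate u.1) 1 + opTensor 1 (annihilate u.2)) =
    opTensor (create u.1) 1 + opTensor 1 (create u.2)
  rw [star_add, opTensor_star, opTensor_star, star_annihilate, star_annihilate, star_one, star_one]

lemma pairAnnihilator_add {H K : Type*} [NormedAddCommGroup H] [InnerProductSpace ℂ H]
    [NormedAddCommGroup K] [InnerProductSpace ℂ K] (u w : H × K) :
    pairAnnihilator (u + w) = pairAnnihilator u + pairAnnihilator w :=
  Subtype.ext (pairAnnih_add u w)

lemma pairAnnihilator_smul {H K : Type*} [NormedAddCommGroup H] [InnerProductSpace ℂ H]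
    [NormedAddCommGroup K] [InnerProductSpace ℂ K] (c : ℂ) (u : H × K) :
    pairAnnihilator (c • u) = star c • pairAnnihilator u :=
  Subtype.ext (pairAnnih_smul c u)

lemma star_pairAnnihilator_mul {H K : Type*} [NormedAddCommGroup H] [InnerProductSpace ℂ H]
    [NormedAddCommGroup K] [InnerProductSpace ℂ K] (v w : K) :
    star (pairAnnihilator ((0 : H), v)) * pairAnnihilator ((0 : H), w) =
      elemTensor 1 (creator v * annihilator w) := by
  have h (v : K) : pairAnnihilator ((0 : H), v) = elemTensor 1 (annihilator v) := by
    apply Subtype.ext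
    change opTensor (annihilate (0 : H)) 1 + opTensor 1 (annihilate v) = opTensor 1 (annihilate v)
    rw [← zero_smul ℂ (0 : H), annihilate_smul, opTensor_smul_left, star_zero, zero_smul, zero_add]
  have h' : star (pairAnnihilator ((0 : H), v)) = elemTensor 1 (creator v) := by
    rw [h]
    apply Subtype.ext
    change star (opTensor 1 (annihilate v)) = opTensor 1 (create v)
    rw [opTensor_star, star_one, star_annihilate]
  rw [h', h, elemTensor_mul, one_mul]

/-- The sesquilinear form `(u, w) ↦ f(D(u)* D(w))`. -/
def starMulForm {A V : Type*} [Ring A] [StarRing A] [Algebra ℂ A] [StarModule ℂ A]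
    [AddCommGroup V] [Module ℂ V] (f : A →ₗ[ℂ] ℂ) (D : V →ₗ⋆[ℂ] A) : V →ₗ[ℂ] V →ₗ⋆[ℂ] ℂ :=
  LinearMap.mk₂'ₛₗ (RingHom.id ℂ) (starRingEnd ℂ) (fun u w => f (star (D u) * D w))
    (fun u u' w => by rw [map_add, star_add, add_mul, map_add])
    (fun c u w => by
      rw [LinearMap.map_smulₛₗ, star_smul, ← starRingEnd_apply, Complex.conj_conj, smul_mul_assoc,
        map_smul, RingHom.id_apply])
    (fun u w w' => by rw [map_add, mul_add, map_add])
    (fun c u w => by rw [LinearMap.map_smulₛₗ, mul_smul_comm, map_smul])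

/-- The sesquilinear form `(u, w) ↦ (ω ⊗ ρ)((pairAnnih u)* (pairAnnih w))`. -/
def twoPointForm (ω : carAlgebra ReservoirSpace →ₗ[ℂ] ℂ)
    (ρ : Fock (SampleSpace d) →L[ℂ] Fock (SampleSpace d)) :
    ReservoirSpace × SampleSpace d →ₗ[ℂ] ReservoirSpace × SampleSpace d →ₗ⋆[ℂ] ℂ :=
  starMulForm (productFunctional ω ρ)
    { toFun := pairAnnihilator
      map_add' := pairAnnihilator_add
      map_smul' := pairAnnihilator_smul }

lemma twoPointForm_apply (ω : carAlgebra ReservoirSpace →ₗ[ℂ] ℂ)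
    (ρ : Fock (SampleSpace d) →L[ℂ] Fock (SampleSpace d)) (u w : ReservoirSpace × SampleSpace d) :
    twoPointForm ω ρ u w =
      productFunctional ω ρ (star (pairAnnihilator u) * pairAnnihilator w) := rfl

/-- The mixed terms factorise through `ω` of a single creator or annihilator, which vanishes by
gauge invariance. -/
lemma twoPointForm_eq {σ : ℝ} (hqf : IsQuasiFree ω ((σ : ℂ) • ContinuousLinearMap.id ℂ _))
    (hω : IsState ω) (hρ : IsDensityMatrix ρ) (u w : ReservoirSpace × SampleSpace d) :
    twoPointForm ω ρ u w = σ * ⟪w.1, u.1⟫_ℂ + traceState ρ (creator u.2 * annihilator w.2) := by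
  -- The quasi-free formula with a determinant of size one.
  have h2 : ω (creator u.1 * annihilator w.1) = σ * ⟪w.1, u.1⟫_ℂ := by
    have h := hqf.1 1 (fun _ => u.1) (fun _ => w.1)
    rw [Matrix.det_fin_one, Matrix.of_apply, smul_apply, inner_smul_right] at h
    simpa using h
  have hc : ω (creator u.1) = 0 := by
    simpa using hqf.2 1 0 (fun _ => u.1) Fin.elim0 (by norm_num)
  have ha : ω (annihilator w.1) = 0 := by
    simpa using hqf.2 0 1 Fin.elim0 (fun _ => w.1) (by norm_num)
  have ht : traceState ρ 1 = 1 := by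
    rw [← hρ.2, traceState]
    simp
  rw [twoPointForm_apply, star_pairAnnihilator, pairAnnihilator_eq]
  simp only [add_mul, mul_add, elemTensor_mul, map_add, productFunctional_elemTensor, mul_one,
    one_mul, h2, hc, ha, ht, hω.1, zero_mul, zero_add, add_zero]

lemma twoPointForm_reservoirBasis {σ : ℝ}
    (hqf : IsQuasiFree ω ((σ : ℂ) • ContinuousLinearMap.id ℂ _))
    (hω : IsState ω) (hρ : IsDensityMatrix ρ) (t : ℕ) (w : ReservoirSpace × SampleSpace d) :
    twoPointForm ω ρ (reservoirBasis t, 0) w = σ * star (w.1 t) ∧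
      twoPointForm ω ρ w (reservoirBasis t, 0) = σ * w.1 t := by
  have hc : creator (0 : SampleSpace d) = 0 := Subtype.ext <| by
    simpa [creator] using create_smul 0 (0 : SampleSpace d)
  have ha : annihilator (0 : SampleSpace d) = 0 := Subtype.ext <| by
    simpa [annihilator] using annihilate_smul 0 (0 : SampleSpace d)
  have h0 : traceState ρ 0 = 0 := by simp [traceState]
  rw [twoPointForm_eq hqf hω hρ, twoPointForm_eq hqf hω hρ, hc, ha, zero_mul, mul_zero, h0,
    ← inner_conj_symm, inner_reservoirBasis]
  simp

end TwoPoint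

/-! ### The recursion for the one-body density matrix and its solution. -/

section Recursion

variable {d : ℕ} [NeZero d] {ω : carAlgebra ReservoirSpace →ₗ[ℂ] ℂ}
  {ρ : Fock (SampleSpace d) →L[ℂ] Fock (SampleSpace d)}

lemma oneBodyMatrix_sampleState_apply (α : ℝ) (W : SampleSpace d ≃ₗᵢ[ℂ] SampleSpace d) (t : ℕ)
    (j k : Fin d) :
    oneBodyMatrix (sampleState α W ω ρ t) j k =
      twoPointForm ω ρ ((oneParticleStep α W ^ t) (0, sampleBasis k))
        ((oneParticleStep α W ^ t) (0, sampleBasis j)) := by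
  -- Sample vectors have zero reservoir component, so they lie in `forwardSpace` by definition.
  rw [twoPointForm_apply, ← evolve_pairAnnihilator α W t (fun _ _ => rfl) (fun _ _ => rfl),
    star_pairAnnihilator_mul]
  rfl

lemma matM_apply (α : ℝ) (W : SampleSpace d ≃ₗᵢ[ℂ] SampleSpace d) (j k : Fin d) :
    matM α W j k = matrixOf W j k + (Real.cos α - 1 : ℝ) * if k = 0 then matrixOf W j 0 else 0 := by
  simp only [matM, mul_add, mul_one, Matrix.add_apply, Matrix.mul_smul, Matrix.smul_apply,
    smul_eq_mul]
  congr 2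
  split_ifs with h
  · subst h; simp
  · exact Matrix.mul_single_apply_of_ne _ _ _ _ _ h _

/-- The matrices `W` and `𝕄` appear conjugated because the map acts on arguments of annihilators
through the inverse of `W`, whose entries are conjugate-transposed. -/
lemma oneParticleStep_sampleBasis (α : ℝ) (W : SampleSpace d ≃ₗᵢ[ℂ] SampleSpace d) (k : Fin d) :
    oneParticleStep α W (0, sampleBasis k) =
      (Complex.I * Real.sin α * star (matrixOf W k 0)) • (reservoirBasis 0, 0) +
        ∑ l, star (matM α W k l) • ((0 : ReservoirSpace), (sampleBasis l : SampleSpace d)) := by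
  have hW (l : Fin d) : ⟪sampleBasis l, W.symm (sampleBasis k)⟫_ℂ = star (matrixOf W k l) := by
    rw [← W.inner_map_map, W.apply_symm_apply, ← inner_conj_symm]
    rfl
  ext1
  · simp [oneParticleStep, hW, Prod.fst_sum]
  · ext i
    have h1 : W.symm (sampleBasis k) i = star (matrixOf W k i) := by
      
      rw [← hW i, sampleBasis, sampleBasis, EuclideanSpace.inner_single_left, map_one, one_mul]
    simp only [oneParticleStep, LinearMap.coe_mk, AddHom.coe_mk, hW, Prod.snd_add, Prod.snd_sum,
      Prod.smul_mk, smul_zero, zero_add, PiLp.add_apply, PiLp.smul_apply, h1, WithLp.ofLp_sum,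
      Finset.sum_apply, matM_apply]
    rcases eq_or_ne i 0 with rfl | hi
    · simp [sampleBasis, PiLp.single_apply, -Complex.ofReal_cos, -Complex.ofReal_sub]
    · simp [sampleBasis, PiLp.single_apply, hi]

lemma oneBodyMatrix_sampleState_succ {σ : ℝ}
    (hqf : IsQuasiFree ω ((σ : ℂ) • ContinuousLinearMap.id ℂ _))
    (hω : IsState ω) (hρ : IsDensityMatrix ρ) (α : ℝ) (W : SampleSpace d ≃ₗᵢ[ℂ] SampleSpace d)
    (t : ℕ) :
    oneBodyMatrix (sampleState α W ω ρ (t + 1)) =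
      matM α W * oneBodyMatrix (sampleState α W ω ρ t) * (matM α W).conjTranspose +
        matB σ α W := by
  ext j k
  have hΨ := twoPointForm_reservoirBasis (ρ := ρ) hqf hω hρ t
  -- Kills the cross terms between the new reservoir mode and the sample terms.
  have h0 (v : SampleSpace d) : ((oneParticleStep α W ^ t) (0, v)).1 t = 0 :=
    oneParticleStep_pow_fst_apply α W t v le_rfl
  have hB : matB σ α W j k = (Real.sin α ^ 2 * σ) * (matrixOf W j 0 * star (matrixOf W k 0)) := by
    simp [matB, Matrix.mul_apply, Matrix.single_apply, ite_and]
    ring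
  -- One step is applied to the basis vector before the other `t`, so that what remains is the form
  -- at time `t`, that is, the entries of the previous density matrix.
  rw [oneBodyMatrix_sampleState_apply, pow_succ, Module.End.mul_apply, Module.End.mul_apply,
    oneParticleStep_sampleBasis, oneParticleStep_sampleBasis]
  simp only [map_add, map_smul, map_sum, oneParticleStep_pow_reservoirBasis, LinearMap.add_apply,
    LinearMap.smul_apply, LinearMap.sum_apply, LinearMap.map_smulₛₗ, (hΨ _).1, (hΨ _).2, h0,
    ← oneBodyMatrix_sampleState_apply]
  simp only [reservoirBasis_apply, if_true, star_zero, star_one, mul_zero, mul_one,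
    Finset.sum_const_zero, add_zero, zero_add, Matrix.add_apply, hB, Matrix.mul_apply,
    Matrix.conjTranspose_apply, smul_eq_mul, Finset.sum_mul, Finset.mul_sum]
  rw [add_comm]
  congr 1
  · rw [Finset.sum_comm]
    refine Finset.sum_congr rfl fun l _ => Finset.sum_congr rfl fun m _ => ?_
    simp
    ring
  · simp [-Complex.ofReal_sin]
    -- The two amplitudes `i sin α` and its conjugate multiply to `sin² α`.
    linear_combination (-(Real.sin α : ℂ) ^ 2 * σ * matrixOf W j 0 *
      (starRingEnd ℂ) (matrixOf W k 0)) * Complex.I_sq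

lemma oneBodyMatrix_sampleState_zero (hω : IsState ω) (α : ℝ)
    (W : SampleSpace d ≃ₗᵢ[ℂ] SampleSpace d) :
    oneBodyMatrix (sampleState α W ω ρ 0) = oneBodyMatrix (traceState ρ) := by
  have h (A : carAlgebra (SampleSpace d)) : sampleState α W ω ρ 0 A = traceState ρ A := by
    have : evolve α W 0 (elemTensor 1 A) = elemTensor 1 A := Subtype.ext (by simp [evolve])
    rw [sampleState, this, productFunctional_elemTensor, hω.1, one_mul]
  rw [funext h]

end Recursion

lemma eq_sum_of_affine_recursion {R : Type*} [Semiring R] {m m' b : R} {x : ℕ → R}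
    (h : ∀ t, x (t + 1) = m * x t * m' + b) (t : ℕ) :
    x t = m ^ t * x 0 * m' ^ t + ∑ r ∈ Finset.range t, m ^ r * b * m' ^ r := by
  induction t with
  | zero => simp
  | succ t ih =>
    -- The term `r = 0` is the newly added `b`; multiplying the old sum by `m` and `m'` raises every
    -- exponent by one.
    rw [h, ih, Finset.sum_range_succ', mul_add, add_mul, Finset.mul_sum, Finset.sum_mul]
    simp only [pow_succ' m, pow_succ m', mul_assoc, pow_zero, one_mul, mul_one, add_assoc]

end FermionicWalk

end

theorem mainTheorem4 (d : ℕ) [NeZero d] (α σ : ℝ) (hσ₀ : 0 ≤ σ) (hσ₁ : σ ≤ 1)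
    (W : FermionicWalk.SampleSpace d ≃ₗᵢ[ℂ] FermionicWalk.SampleSpace d)
    (ω : FermionicWalk.carAlgebra FermionicWalk.ReservoirSpace →ₗ[ℂ] ℂ)
    (hω : FermionicWalk.IsState ω)
    (hqf : FermionicWalk.IsQuasiFree ω ((σ : ℂ) • ContinuousLinearMap.id ℂ _))
    (ρ : FermionicWalk.Fock (FermionicWalk.SampleSpace d) →L[ℂ]
      FermionicWalk.Fock (FermionicWalk.SampleSpace d))
    (hρ : FermionicWalk.IsDensityMatrix ρ) :
    FermionicWalk.oneBodyMatrix (FermionicWalk.sampleState α W ω ρ 0) =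
        FermionicWalk.oneBodyMatrix (FermionicWalk.traceState ρ) ∧
      (∀ t : ℕ, FermionicWalk.oneBodyMatrix (FermionicWalk.sampleState α W ω ρ (t + 1)) =
        FermionicWalk.matM α W * FermionicWalk.oneBodyMatrix (FermionicWalk.sampleState α W ω ρ t) *
            (FermionicWalk.matM α W).conjTranspose +
          FermionicWalk.matB σ α W) ∧
      ∀ t : ℕ, FermionicWalk.oneBodyMatrix (FermionicWalk.sampleState α W ω ρ t) =
        FermionicWalk.matM α W ^ t * FermionicWalk.oneBodyMatrix (FermionicWalk.traceState ρ) *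
            (FermionicWalk.matM α W).conjTranspose ^ t +
          ∑ r ∈ Finset.range t, FermionicWalk.matM α W ^ r * FermionicWalk.matB σ α W *
            (FermionicWalk.matM α W).conjTranspose ^ r := by
  have h0 := FermionicWalk.oneBodyMatrix_sampleState_zero (ρ := ρ) hω α W
  have hs := FermionicWalk.oneBodyMatrix_sampleState_succ hqf hω hρ α W
  refine ⟨h0, hs, fun t => ?_⟩
  rw [← h0]
  exact FermionicWalk.eq_sum_of_affine_recursion
    (x := fun t => FermionicWalk.oneBodyMatrix (FermionicWalk.sampleState α W ω ρ t)) hs t
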